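/- Let $f_j=\prod_{i\ge1}(1-q^{ji})\in\mathbb Z[[q]]$ for $j\ge 1$, and define $b_{25}(n)$ by $\sum_{n\ge0}b_{25}(n)q^n=f_{25}/f_1$ (so $b_{25}(n)$ is the number of partitions of $n$ with no part divisible by $25$). A sequence $(a(n))_{n\ge0}$ of integers is called lacunary modulo 2 if $\lim_{x\to\infty}\frac1x\#\{0\le n\le x: a(n)\text{ odd}\}=0$. A congruence modulo 2 between power series is meant coefficient by coefficient. **Theorem.** Each of the sequences $\big(b_{25}(4n)\big)_{n\ge0}$, $\big(b_{25}(4n+1)\big)_{n\ge0}$ and $\big(b_{25}(8n+3)\big)_{n\ge0}$ is not identically zero modulo 2, but is lacunary modulo 2. Moreover: 1. If $p$ is a prime with $p\equiv31$ or $39\pmod{40}$, then for every integer $4^{-1}$ inverse to $4$ modulo $p^2$, every integer $k$ with $1\le k<p$, and every integer $n$ such that $p^2n+pk-4^{-1}\ge0$, the number $b_{25}\big(4(p^2n+pk-4^{-1})\big)$ is even. 2. If $p$ is a prime with $p\equiv31$ or $39\pmod{40}$, then for every integer $2^{-1}$ inverse to $2$ modulo $p^2$, every integer $k$ with $1\le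 k<p$, and every integer $n$ such that $p^2n+pk-2^{-1}\ge0$, the number $b_{25}\big(4(p^2n+pk-2^{-1})+1\big)$ is even. 3. $b_{25}(40n+34)$ is even for all $n\ge0$. 4. $\displaystyle\sum_{n\ge0}b_{25}(8n+3)q^n\equiv f_1^{12}+q^{12}f_{25}^{12}\pmod 2$. Consequently $b_{25}(8n+3)$ is even whenever $n\ge0$ is neither of the form $4\binom{t+1}2$ nor of the form $12+100\binom{t+1}2$ with an integer $t\ge0$. Furthermore, there are infinitely many arithmetic progressions $\{An+B:n\ge0\}$ contained in $\{8n+3:n\ge0\}$, none of them contained in another, among them $\{16n+11:n\ge 0\}$, such that $b_{25}(N)$ is even for every member $N$ of each of them. In particular, $b_{25}(16n+11)$ is even for all $n\ge0$. -/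

import Mathlib

open scoped PowerSeries.WithPiTopology

/-- The formal power series `f_j = ∏_{i ≥ 1} (1 - q^{j i})` over `ℤ` (for `j ≥ 1`), as an infinite
product in the topology of coefficientwise convergence. -/
noncomputable def eulerF (j : ℕ) : PowerSeries ℤ :=
  ∏' i : ℕ, (1 - (PowerSeries.X : PowerSeries ℤ) ^ (j * (i + 1)))

/-- The product that defines `eulerF j` converges for `j ≥ 1`. -/
theorem multipliable_eulerF {j : ℕ} (hj : 0 < j) :
    Multipliable fun i : ℕ => 1 - (PowerSeries.X : PowerSeries ℤ) ^ (j * (i + 1)) := by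
  have h := PowerSeries.WithPiTopology.multipliable_one_add_of_tendsto_order_atTop_nhds_top
    (R := ℤ) (f := fun i : ℕ => - (PowerSeries.X : PowerSeries ℤ) ^ (j * (i + 1))) (by
      refine ENat.tendsto_nhds_top_iff_natCast_lt.mpr fun n => ?_
      refine Filter.eventually_atTop.mpr ⟨n, fun i hi => ?_⟩
      rw [PowerSeries.order_neg, PowerSeries.order_X_pow]
      exact_mod_cast (by nlinarith : n < j * (i + 1)))
  simpa [sub_eq_add_neg] using h

theorem constantCoeff_eulerF {j : ℕ} (hj : 0 < j) :
    PowerSeries.constantCoeff (eulerF j) = 1 := by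
  have h := (multipliable_eulerF hj).map_tprod
    (PowerSeries.constantCoeff (R := ℤ)) (PowerSeries.WithPiTopology.continuous_constantCoeff ℤ)
  rw [eulerF, h]
  simp [hj.ne']

/-- `B_m(q) = f_m / f_1`: the constant coefficient of `f_1` is `1`, so that `f_1` is a unit of
`ℤ⟦q⟧` whose inverse is `PowerSeries.invOfUnit (eulerF 1) 1`. -/
noncomputable def regularGF (m : ℕ) : PowerSeries ℤ :=
  eulerF m * PowerSeries.invOfUnit (eulerF 1) 1

theorem regularGF_mul_eulerF_one (m : ℕ) : regularGF m * eulerF 1 = eulerF m := by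
  rw [regularGF, mul_assoc, mul_comm (PowerSeries.invOfUnit _ _),
    PowerSeries.mul_invOfUnit _ _ (by simp [constantCoeff_eulerF]), mul_one]

/-- `b_m(n)`: the coefficient of `q^n` in `B_m(q)`, i.e. the number of `m`-regular partitions
of `n`. -/
noncomputable def regularB (m n : ℕ) : ℤ := PowerSeries.coeff n (regularGF m)

/-- The sequence `a` has odd density `δ`: the proportion of `n ≤ x` for which `a n` is odd tends
to `δ` as `x → ∞`. -/
def HasOddDensity (a : ℕ → ℤ) (δ : ℝ) : Prop :=
  Filter.Tendsto
    (fun x : ℕ => (((Finset.range (x + 1)).filter fun n => Odd (a n)).card : ℝ) / (x : ℝ))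
    Filter.atTop (nhds δ)

/-- Lacunary modulo 2: odd density zero. -/
def LacunaryModTwo (a : ℕ → ℤ) : Prop := HasOddDensity a 0

/-- Congruence modulo 2 of power series: coefficient by coefficient. -/
def SeriesModEqTwo (f g : PowerSeries ℤ) : Prop :=
  ∀ n : ℕ, PowerSeries.coeff n f ≡ PowerSeries.coeff n g [ZMOD 2]

/-- The arithmetic progression `{A n + B : n ≥ 0}`. -/
def arithProg (A B : ℕ) : Set ℕ := Set.range fun n : ℕ => A * n + B

/-!
Everything takes place in the power series over `ZMod 2`, where squaring a series doubles its
exponents and a family of exponents contributes only through the parity of its fibres, so that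
involutions on the index sets give identities of series. Write `F`, `G`, `H` for `f_1`, `f_5`, `f_25`
modulo 2, and `K = q * H`.

The pentagonal number theorem and two involutions in `ℤ[√-2]` and `ℤ[√-5]` give
`F ^ 3 = ∑ q ^ ((c ^ 2 - 1) / 8)` over `c ≡ 1` modulo 4 (`eulerMod_one_pow_three`) and
`F * G = F ^ 6 + q * G ^ 6` (`eulerMod_one_mul_five`). The second identity, together with its image
under `q ↦ q ^ 5`, splits `H / F = (G / F) * (H / G)` into parts with even and odd exponents.
Repeating the step yields

* `∑ b (8 * n + 3) q ^ n = F ^ 12 + K ^ 12` (`regularMod_eight_mul_add_three`),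
* `∑ b (4 * n + 1) q ^ n = (F ^ 6 + K ^ 6) * (F ^ 6 + q * G ^ 6)` (`regularMod_four_mul_add_one`),
* `∑ b (8 * n + 2) q ^ n = G * K ^ 2 * (F ^ 2 + F * K)` (`regularMod_eight_mul_add_two`),
* `∑ b (4 * n) q ^ n = F ^ 6 + q * G ^ 6 + K ^ 6 + F ^ 3 * K ^ 3 + Λ` (`regularMod_four_mul`), where
  `Λ = F * K ^ 5 + F ^ 4 * K ^ 2`.

The first two series are supported on values of explicit quadratic forms, and the third avoids the
exponents congruent to 4 modulo 5. The term `Λ` is the difficult one: it is a Lambert series that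
counts the factorizations `4 * n + 1 = d * e` with `(d, e) ≡ (3, 7)` or `(1, 9)` modulo 20
(`lambert_add_lambert`). This follows from the 5-dissections of `F` and `F ^ 3`, and from the product
of the Lambert series with `∑ q ^ (v ^ 2)`, which is evaluated by counting indefinite quadratic forms
modulo 2 by their signs at `∞`, `0` and `1` (`even_ncard_crossing`, `lambert_mul_squares`), in the
spirit of the proof by Heath-Brown and Zagier of the two-square theorem.

A prime `p ≡ 11` or `19` modulo 20 has 5 as a square and -1 and -5 as non-squares. If it divides
`4 * n + 1` exactly once, the quadratic forms do not contribute to `b (4 * n)`, and the factorizations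
cancel in pairs (`even_regularB_four_mul`); the other sequences are similar. The assertions on the
progressions modulo `p ^ 2` follow. So does lacunarity: the reciprocals of the primes `p ≡ 31` modulo 40
have a divergent sum (`not_summable_inv_primes_residueClass`), and a sieve shows that almost all `n`
are such that one of these primes divides `4 * n + 1`, or `2 * n + 1`, exactly once
(`lacunaryModTwo_of_exact`).
-/

/-! ### Generating functions modulo 2 -/

/-- The generating function modulo 2 of a family of exponents: the coefficient of `q ^ n` in
`qSum s e` is the parity of the number of `i ∈ s` with `e i = n`. It is meaningful when every
exponent is attained finitely often (`FinFib s e`). -/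
noncomputable def qSum {ι : Type*} (s : Set ι) (e : ι → ℕ) : PowerSeries (ZMod 2) :=
  PowerSeries.mk fun n => ({i | i ∈ s ∧ e i = n}.ncard : ZMod 2)

/-- Every exponent is attained finitely often by `e` on `s`. -/
def FinFib {ι : Type*} (s : Set ι) (e : ι → ℕ) : Prop :=
  ∀ n, {i | i ∈ s ∧ e i = n}.Finite

theorem coeff_qSum {ι : Type*} (s : Set ι) (e : ι → ℕ) (n : ℕ) :
    PowerSeries.coeff n (qSum s e) = ({i | i ∈ s ∧ e i = n}.ncard : ZMod 2) := by
  simp [qSum]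

theorem FinFib.finite_le {ι : Type*} {s : Set ι} {e : ι → ℕ} (hs : FinFib s e) (n : ℕ) :
    {i | i ∈ s ∧ e i ≤ n}.Finite := by
  refine ((Set.finite_Iic n).biUnion fun m _ => hs m).subset ?_
  rintro i ⟨hi, hn⟩
  simpa using ⟨hi, hn⟩

theorem FinFib.prod {ι κ : Type*} {s : Set ι} {t : Set κ} {e : ι → ℕ} {f : κ → ℕ}
    (hs : FinFib s e) (ht : FinFib t f) :
    FinFib (s ×ˢ t) (fun p => e p.1 + f p.2) := by
  intro n
  refine ((hs.finite_le n).prod (ht.finite_le n)).subset ?_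
  rintro ⟨i, j⟩ ⟨⟨hi, hj⟩, h⟩
  simp only at hi hj h
  exact ⟨⟨hi, by simp only; omega⟩, ⟨hj, by simp only; omega⟩⟩

theorem qSum_mul {ι κ : Type*} {s : Set ι} {t : Set κ} {e : ι → ℕ} {f : κ → ℕ}
    (hs : FinFib s e) (ht : FinFib t f) :
    qSum s e * qSum t f = qSum (s ×ˢ t) (fun p => e p.1 + f p.2) := by
  classical
  ext n
  rw [PowerSeries.coeff_mul, coeff_qSum, Set.ncard_eq_toFinset_card _ (hs.prod ht n),
    Finset.card_eq_sum_card_fiberwise (f := fun p => (e p.1, f p.2))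
      (t := Finset.HasAntidiagonal.antidiagonal n) (by
        intro p hp
        simp only [Set.Finite.coe_toFinset, Set.mem_ofPred_eq] at hp
        simpa using hp.2), Nat.cast_sum]
  refine Finset.sum_congr rfl fun x hx => ?_
  rw [coeff_qSum, coeff_qSum, ← Nat.cast_mul, ← Set.ncard_prod, ← Set.ncard_coe_finset]
  congr 2
  rw [Finset.HasAntidiagonal.mem_antidiagonal] at hx
  ext ⟨i, j⟩
  simp only [Set.mem_prod, Set.mem_ofPred_eq, Finset.coe_filter, Set.Finite.mem_toFinset,
    Prod.ext_iff]
  constructor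
  · rintro ⟨⟨h1, h2⟩, h3, h4⟩
    exact ⟨⟨⟨h1, h3⟩, by omega⟩, h2, h4⟩
  · rintro ⟨⟨⟨h1, h3⟩, _⟩, h2, h4⟩
    exact ⟨⟨h1, h2⟩, h3, h4⟩

/-- Two families with equinumerous fibres have the same generating function. -/
theorem qSum_congr {ι κ : Type*} {s : Set ι} {t : Set κ} {e : ι → ℕ} {f : κ → ℕ}
    (g : ι → κ) (h : κ → ι) (hg : ∀ i ∈ s, g i ∈ t ∧ f (g i) = e i ∧ h (g i) = i)
    (hh : ∀ j ∈ t, h j ∈ s ∧ e (h j) = f j ∧ g (h j) = j) :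
    qSum s e = qSum t f := by
  ext n
  rw [coeff_qSum, coeff_qSum]
  congr 1
  refine Set.ncard_congr (fun i _ => g i) ?_ ?_ ?_
  · rintro i ⟨hi, hn⟩
    exact ⟨(hg i hi).1, by rw [(hg i hi).2.1, hn]⟩
  · rintro i i' ⟨hi, _⟩ ⟨hi', _⟩ he
    rw [← (hg i hi).2.2, ← (hg i' hi').2.2, he]
  · rintro j ⟨hj, hn⟩
    exact ⟨h j, ⟨(hh j hj).1, by rw [(hh j hj).2.1, hn]⟩, (hh j hj).2.2⟩

theorem qSum_union {ι : Type*} {s t : Set ι} {e : ι → ℕ} (hs : FinFib s e) (ht : FinFib t e)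
    (hst : Disjoint s t) : qSum (s ∪ t) e = qSum s e + qSum t e := by
  ext n
  rw [map_add, coeff_qSum, coeff_qSum, coeff_qSum, ← Nat.cast_add,
    ← Set.ncard_union_eq _ (hs n) (ht n)]
  · congr 2
    ext i
    simp only [Set.mem_union, Set.mem_ofPred_eq]
    tauto
  · exact hst.mono (fun i hi => hi.1) (fun i hi => hi.1)

theorem FinFib.mono {ι : Type*} {s t : Set ι} {e : ι → ℕ} (ht : FinFib t e) (hst : s ⊆ t) :
    FinFib s e :=
  fun n => (ht n).subset fun _ hi => ⟨hst hi.1, hi.2⟩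

theorem ncard_even_of_involution {α : Type*} {s : Set α} (f : α → α)
    (hf : ∀ x ∈ s, f x ∈ s) (hff : ∀ x ∈ s, f (f x) = x) (hne : ∀ x ∈ s, f x ≠ x) :
    Even s.ncard := by
  rcases s.finite_or_infinite with hs | hs
  · rw [Set.ncard_eq_toFinset_card _ hs, ← ZMod.natCast_eq_zero_iff_even]
    have := Finset.sum_involution (s := hs.toFinset) (f := fun _ => (1 : ZMod 2))
      (fun a _ => f a) (fun _ _ => by decide) (fun a ha _ => hne a (by simpa using ha))
      (fun a ha => by simpa using hf a (by simpa using ha))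
      (fun a ha => hff a (by simpa using ha))
    simpa using this
  · simp [hs.ncard]

/-- The cardinality of a finite set has the parity of the number of fixed points of an
involution. -/
theorem ncard_eq_fixedPoints {α : Type*} {s : Set α} (hs : s.Finite) (f : α → α)
    (hf : ∀ x ∈ s, f x ∈ s) (hff : ∀ x ∈ s, f (f x) = x) :
    (s.ncard : ZMod 2) = ({x | x ∈ s ∧ f x = x}.ncard : ZMod 2) := by
  have h1 : s = {x | x ∈ s ∧ f x = x} ∪ {x | x ∈ s ∧ f x ≠ x} := by
    ext x
    simp only [Set.mem_union, Set.mem_ofPred_eq]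
    tauto
  have h2 : Even {x | x ∈ s ∧ f x ≠ x}.ncard := by
    refine ncard_even_of_involution f ?_ (fun x hx => hff x hx.1) (fun x hx => hx.2)
    rintro x ⟨hx, hne⟩
    exact ⟨hf x hx, by rw [hff x hx]; exact hne.symm⟩
  conv_lhs => rw [h1]
  rw [Set.ncard_union_eq _ (hs.subset fun x hx => hx.1) (hs.subset fun x hx => hx.1),
    Nat.cast_add, (ZMod.natCast_eq_zero_iff_even).2 h2, add_zero]
  rw [Set.disjoint_left]
  exact fun x hx hx' => hx'.2 hx.2

/-- An involution with fixed-point set `t` gives equality of generating functions. -/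
theorem qSum_eq_of_involution {ι : Type*} {s : Set ι} {e : ι → ℕ} (hs : FinFib s e) (f : ι → ι)
    (hf : ∀ x ∈ s, f x ∈ s ∧ e (f x) = e x ∧ f (f x) = x) :
    qSum s e = qSum {x | x ∈ s ∧ f x = x} e := by
  ext n
  rw [coeff_qSum, coeff_qSum, ncard_eq_fixedPoints (hs n) f]
  · congr 2
    ext x
    simp only [Set.mem_ofPred_eq]
    tauto
  · rintro x ⟨hx, hn⟩
    exact ⟨(hf x hx).1, by rw [(hf x hx).2.1, hn]⟩
  · exact fun x hx => (hf x hx.1).2.2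

theorem qSum_eq_zero_of_involution {ι : Type*} {s : Set ι} {e : ι → ℕ} (f : ι → ι)
    (hf : ∀ x ∈ s, f x ∈ s ∧ e (f x) = e x ∧ f (f x) = x ∧ f x ≠ x) :
    qSum s e = 0 := by
  ext n
  rw [coeff_qSum, map_zero, ZMod.natCast_eq_zero_iff_even]
  refine ncard_even_of_involution f ?_ (fun x hx => (hf x hx.1).2.2.1)
    (fun x hx => (hf x hx.1).2.2.2)
  rintro x ⟨hx, hn⟩
  exact ⟨(hf x hx).1, by rw [(hf x hx).2.1, hn]⟩

/-- A multiple of this identity makes up for the integer coefficients in each `linear_combination`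
over `PowerSeries (ZMod 2)`. -/
theorem two_eq_zero_series : (2 : PowerSeries (ZMod 2)) = 0 := by
  have : (2 : ZMod 2) = 0 := by decide
  rw [← map_ofNat (PowerSeries.C (R := ZMod 2)) 2, this, map_zero]

/-- Squaring modulo 2 doubles the exponents. -/
theorem qSum_sq {ι : Type*} {s : Set ι} {e : ι → ℕ} (hs : FinFib s e) :
    qSum s e ^ 2 = qSum s (fun i => 2 * e i) := by
  rw [sq, qSum_mul hs hs, qSum_eq_of_involution (hs.prod hs) Prod.swap]
  · refine qSum_congr Prod.fst (fun i => (i, i)) ?_ ?_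
    · rintro ⟨i, j⟩ ⟨⟨hi, hj⟩, h⟩
      simp only [Prod.swap_prod_mk, Prod.mk.injEq] at h
      obtain ⟨rfl, -⟩ := h
      exact ⟨hi, by simp only; ring, rfl⟩
    · intro i hi
      exact ⟨⟨⟨hi, hi⟩, rfl⟩, by simp only; ring, rfl⟩
  · rintro ⟨i, j⟩ ⟨hi, hj⟩
    exact ⟨⟨hj, hi⟩, add_comm _ _, rfl⟩

theorem qSum_X_pow_mul {ι : Type*} {s : Set ι} {e : ι → ℕ} (k : ℕ) :
    PowerSeries.X ^ k * qSum s e = qSum s (fun i => e i + k) := by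
  ext n
  rw [PowerSeries.coeff_X_pow_mul', coeff_qSum]
  split_ifs with h
  · rw [coeff_qSum]
    congr 2
    ext i
    simp only [Set.mem_ofPred_eq]
    exact and_congr_right fun _ => by omega
  · rw [eq_comm, coeff_qSum, show {i | i ∈ s ∧ e i + k = n} = ∅ from ?_]
    · simp
    · ext i
      simp only [Set.mem_ofPred_eq, Set.mem_empty_iff_false, iff_false, not_and]
      intro _; omega

theorem expand_qSum {ι : Type*} {s : Set ι} {e : ι → ℕ} (k : ℕ) (hk : k ≠ 0) :
    PowerSeries.expand k hk (qSum s e) = qSum s (fun i => k * e i) := by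
  ext n
  rw [PowerSeries.coeff_expand, coeff_qSum]
  split_ifs with h
  · obtain ⟨m, rfl⟩ := h
    rw [Nat.mul_div_cancel_left _ (Nat.pos_of_ne_zero hk), coeff_qSum]
    congr 2
    ext i
    simp [hk]
  · rw [eq_comm, coeff_qSum, show {i | i ∈ s ∧ k * e i = n} = ∅ from ?_]
    · simp
    · ext i
      simp only [Set.mem_ofPred_eq, Set.mem_empty_iff_false, iff_false, not_and]
      rintro _ rfl
      exact h (dvd_mul_right _ _)

theorem FinFib.of_injective {ι : Type*} {s : Set ι} {e : ι → ℕ} (h : Set.InjOn e s) :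
    FinFib s e := by
  intro n
  refine Set.Subsingleton.finite ?_
  rintro i ⟨hi, hn⟩ j ⟨hj, hn'⟩
  exact h hi hj (hn.trans hn'.symm)

theorem FinFib.mul_add {ι : Type*} {s : Set ι} {e : ι → ℕ} (hs : FinFib s e) (k : ℕ)
    (hk : k ≠ 0) (l : ℕ) :
    FinFib s (fun i => k * e i + l) := by
  intro n
  refine (hs.finite_le n).subset ?_
  rintro i ⟨hi, hn⟩
  refine ⟨hi, ?_⟩
  have := Nat.le_mul_of_pos_left (e i) (Nat.pos_of_ne_zero hk)
  simp only at hn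
  omega

/-! ### Euler's product modulo 2 -/

/-- `f_j` modulo 2. -/
noncomputable def eulerMod (j : ℕ) : PowerSeries (ZMod 2) :=
  PowerSeries.map (Int.castRingHom (ZMod 2)) (eulerF j)

/-- The pentagonal number theorem. -/
theorem eulerF_one_eq : eulerF 1 = PowerSeries.pentagonalSeries ℤ := by
  rw [eulerF, ← PowerSeries.WithPiTopology.tprod_one_sub_X_pow]
  simp

theorem eulerF_eq_expand (j : ℕ) (hj : j ≠ 0) :
    eulerF j = PowerSeries.expand j hj (eulerF 1) := by
  have hc : Continuous (PowerSeries.expand (R := ℤ) j hj) := by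
    rw [continuous_iff_continuousAt]
    intro f
    rw [ContinuousAt, PowerSeries.WithPiTopology.tendsto_iff_coeff_tendsto]
    intro n
    by_cases h : j ∣ n
    · simp only [PowerSeries.coeff_expand, h, if_true]
      exact (PowerSeries.WithPiTopology.continuous_coeff ℤ _).tendsto f
    · simp only [PowerSeries.coeff_expand, h, if_false]
      exact tendsto_const_nhds
  rw [eulerF, eulerF, Multipliable.map_tprod (multipliable_eulerF one_pos) _ hc]
  simp [pow_mul]

theorem eulerMod_one : eulerMod 1 = qSum Set.univ pentagonal := by
  ext n
  rw [eulerMod, eulerF_one_eq, coeff_qSum, PowerSeries.coeff_map]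
  by_cases h : n ∈ Set.range pentagonal
  · obtain ⟨k, rfl⟩ := h
    rw [PowerSeries.coeff_pentagonalSeries_pentagonal]
    have : {i | i ∈ Set.univ ∧ pentagonal i = pentagonal k} = {k} := by
      ext i; simp
    rw [this, Set.ncard_singleton]
    rcases Int.even_or_odd k with hk | hk
    · simp [Int.negOnePow_even k hk]
    · simp [Int.negOnePow_odd k hk]
  · rw [PowerSeries.coeff_pentagonalSeries_eq_zero ℤ h]
    rw [show {i | i ∈ Set.univ ∧ pentagonal i = n} = ∅ from ?_]
    · simp
    · ext i
      simp only [Set.mem_univ, true_and, Set.mem_ofPred_eq, Set.mem_empty_iff_false, iff_false]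
      exact fun hi => h ⟨i, hi⟩

/-- The series `f_j` is `f_1` at `q ^ j`. -/
theorem eulerMod_eq_expand (j : ℕ) (hj : j ≠ 0) :
    eulerMod j = PowerSeries.expand j hj (eulerMod 1) := by
  rw [eulerMod, eulerF_eq_expand j hj, PowerSeries.map_expand, eulerMod]

/-! ### Theta series of odd squares and of binary forms -/

/-- The exponent `(c ^ 2 - 1) / 8` attached to an odd integer `c`. -/
def sqExp (c : ℤ) : ℕ := ((c ^ 2 - 1) / 8).toNat

theorem sqExp_spec {c : ℤ} (hc : c % 2 = 1) : 8 * (sqExp c : ℤ) + 1 = c ^ 2 := by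
  obtain ⟨k, rfl⟩ : ∃ k, c = 2 * k + 1 := ⟨c / 2, by omega⟩
  obtain ⟨r, hr⟩ := Int.even_mul_succ_self k
  have h1 : (2 * k + 1) ^ 2 - 1 = 8 * r := by linear_combination 4 * hr
  have h2 : 0 ≤ 8 * r := by
    rw [← h1]
    rcases le_or_gt 0 k with h | h <;> nlinarith
  rw [sqExp, h1]
  omega

theorem sqExp_eq_iff {c : ℤ} (hc : c % 2 = 1) (n : ℕ) : sqExp c = n ↔ c ^ 2 = 8 * n + 1 := by
  have := sqExp_spec hc
  omega

theorem sqExp_neg (c : ℤ) : sqExp (-c) = sqExp c := by simp [sqExp]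

theorem finFib_sqExp {s : Set ℤ} (hs : ∀ c ∈ s, c % 2 = 1) : FinFib s sqExp := by
  intro n
  refine (Set.finite_Icc (-(8 * n + 1 : ℤ)) (8 * n + 1)).subset ?_
  rintro c ⟨hc, hn⟩
  rw [sqExp_eq_iff (hs c hc)] at hn
  constructor <;> nlinarith

/-- `∑ q ^ ((c ^ 2 - 1) / 8)` over the integers `c ≡ r` modulo `m`. -/
noncomputable def oddSquares (m r : ℤ) : PowerSeries (ZMod 2) := qSum {c | c % m = r} sqExp

theorem pentagonal_spec (k : ℤ) : 24 * (pentagonal k : ℤ) + 1 = (6 * k - 1) ^ 2 := by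
  linear_combination 12 * two_mul_natCast_pentagonal k

theorem finFib_pentagonal : FinFib Set.univ pentagonal :=
  FinFib.of_injective pentagonal_injective.injOn

/-- The exponent `(c ^ 2 + 2 * d ^ 2 - 1) / 8`. -/
def formTwoExp (p : ℤ × ℤ) : ℕ := ((p.1 ^ 2 + 2 * p.2 ^ 2 - 1) / 8).toNat

theorem formTwoExp_spec {c d : ℤ} (hc : c % 2 = 1) (hd : d % 2 = 0) :
    8 * (formTwoExp (c, d) : ℤ) + 1 = c ^ 2 + 2 * d ^ 2 := by
  have h := sqExp_spec hc
  obtain ⟨k, rfl⟩ : ∃ k, d = 2 * k := ⟨d / 2, by omega⟩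
  have h1 : c ^ 2 + 2 * (2 * k) ^ 2 - 1 = 8 * (sqExp c + k ^ 2) := by linear_combination -h
  have h2 := sq_nonneg k
  simp only [formTwoExp]
  rw [h1, Int.mul_ediv_cancel_left _ (by norm_num), Int.toNat_of_nonneg (by positivity)]
  linear_combination h

/-- The exponent `(c ^ 2 + 5 * d ^ 2 - 1) / 4`. -/
def formFiveExp (p : ℤ × ℤ) : ℕ := ((p.1 ^ 2 + 5 * p.2 ^ 2 - 1) / 4).toNat

theorem formFiveExp_spec {c d : ℤ} (h : (c + d) % 2 = 1) :
    4 * (formFiveExp (c, d) : ℤ) + 1 = c ^ 2 + 5 * d ^ 2 := by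
  obtain ⟨k, hk⟩ : ∃ k, c = 2 * k + 1 - d := ⟨(c + d) / 2, by omega⟩
  obtain ⟨r, hr⟩ := Int.even_mul_succ_self d
  have h1 : c ^ 2 + 5 * d ^ 2 - 1 = 4 * (k ^ 2 + k - k * d + d ^ 2 + r - d) := by
    rw [hk]; linear_combination 2 * hr
  have h2 : 0 < c ^ 2 + 5 * d ^ 2 := by
    by_contra hcon
    have hc0 : c = 0 := by nlinarith [sq_nonneg c, sq_nonneg d]
    have hd0 : d = 0 := by nlinarith [sq_nonneg c, sq_nonneg d]
    subst hc0; subst hd0; simp at h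
  simp only [formFiveExp]
  rw [h1, Int.mul_ediv_cancel_left _ (by norm_num), Int.toNat_of_nonneg (by linarith)]
  linear_combination -h1

theorem finFib_formTwoExp {s : Set (ℤ × ℤ)} (hs : ∀ p ∈ s, p.1 % 2 = 1 ∧ p.2 % 2 = 0) :
    FinFib s formTwoExp := by
  intro n
  refine ((Set.finite_Icc (-(8 * n + 1 : ℤ)) (8 * n + 1)).prod
    (Set.finite_Icc (-(8 * n + 1 : ℤ)) (8 * n + 1))).subset ?_
  rintro ⟨c, d⟩ ⟨hc, hn⟩
  have h := formTwoExp_spec (hs _ hc).1 (hs _ hc).2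
  simp only at h
  rw [hn] at h
  refine ⟨⟨?_, ?_⟩, ⟨?_, ?_⟩⟩ <;> simp only <;> nlinarith

theorem finFib_formFiveExp {s : Set (ℤ × ℤ)} (hs : ∀ p ∈ s, (p.1 + p.2) % 2 = 1) :
    FinFib s formFiveExp := by
  intro n
  refine ((Set.finite_Icc (-(4 * n + 1 : ℤ)) (4 * n + 1)).prod
    (Set.finite_Icc (-(4 * n + 1 : ℤ)) (4 * n + 1))).subset ?_
  rintro ⟨c, d⟩ ⟨hc, hn⟩
  have h := formFiveExp_spec (hs _ hc)
  simp only at h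
  rw [hn] at h
  refine ⟨⟨?_, ?_⟩, ⟨?_, ?_⟩⟩ <;> simp only <;> nlinarith

/-- Separation of the pairs that a norm equation produces from those that cancel. -/
theorem split_by_three {e : ℤ × ℤ → ℕ} {s : Set (ℤ × ℤ)} (hs : FinFib s e) :
    qSum s e = qSum {p | p ∈ s ∧ (p.1 + p.2) % 3 ≠ 0} e +
      qSum {p | p ∈ s ∧ (p.1 + p.2) % 3 = 0} e := by
  rw [← qSum_union (hs.mono fun _ h => h.1) (hs.mono fun _ h => h.1)]
  · congr 1
    ext p
    simp only [Set.mem_union, Set.mem_ofPred_eq]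
    tauto
  · exact Set.disjoint_left.2 fun p h h' => h.2 h'.2

/-- Jacobi's identity for `f_1 ^ 3`, modulo 2. In `f_1 * f_1 ^ 2` the exponents are given by
`(6 m - 1) ^ 2 + 2 * (6 k - 1) ^ 2 = 3 * (c ^ 2 + 2 * d ^ 2)`; division by `1 + √-2` turns the pairs
`(m, k)` into the pairs `(c, d)` up to sign with `3 ∤ c + d`. The pairs with `3 ∣ c + d` cancel
by complex conjugation before the division, and all pairs but those with `d = 0` cancel by
conjugation after it. -/
theorem eulerMod_one_pow_three : eulerMod 1 ^ 3 = oddSquares 4 1 := by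
  have hR : ∀ p ∈ {p : ℤ × ℤ | p.1 % 2 = 1 ∧ p.2 % 2 = 0 ∧ (p.1 + p.2) % 4 = 1},
    p.1 % 2 = 1 ∧ p.2 % 2 = 0 := fun p hp => ⟨hp.1, hp.2.1⟩
  have h1 : eulerMod 1 ^ 3 = qSum {p : ℤ × ℤ | (p.1 % 2 = 1 ∧ p.2 % 2 = 0 ∧ (p.1 + p.2) % 4 = 1)
      ∧ (p.1 + p.2) % 3 ≠ 0} formTwoExp := by
    rw [pow_succ', eulerMod_one, qSum_sq finFib_pentagonal,
      qSum_mul (f := fun k => 2 * pentagonal k) finFib_pentagonal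
        (finFib_pentagonal.mul_add 2 two_ne_zero 0)]
    refine qSum_congr
      (fun p => if (6 * p.2 - 1) % 4 = 1 then (2 * p.1 + 4 * p.2 - 1, 2 * p.2 - 2 * p.1)
        else (-(2 * p.1 + 4 * p.2 - 1), -(2 * p.2 - 2 * p.1)))
      (fun p => if (p.1 + p.2) % 6 = 5 then ((p.1 + p.2 + 1) / 6 - p.2 / 2, (p.1 + p.2 + 1) / 6)
        else ((-p.1 - p.2 + 1) / 6 + p.2 / 2, (-p.1 - p.2 + 1) / 6)) ?_ ?_
    · rintro ⟨m, k⟩ -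
      have e1 := pentagonal_spec m
      have e2 := pentagonal_spec k
      dsimp only
      split_ifs with h1 h2 h2
      · have e3 := formTwoExp_spec (c := 2 * m + 4 * k - 1) (d := 2 * k - 2 * m)
          (by omega) (by omega)
        refine ⟨⟨⟨by dsimp only; omega, by dsimp only; omega, by dsimp only; omega⟩,
          by dsimp only; omega⟩, ?_, ?_⟩
        · zify; linarith
        · dsimp only at h2 ⊢
          ext <;> dsimp only <;> omega
      · dsimp only at h2; omega
      · dsimp only at h2; omega
      · have e3 := formTwoExp_spec (c := -(2 * m + 4 * k - 1)) (d := -(2 * k - 2 * m))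
          (by omega) (by omega)
        refine ⟨⟨⟨by dsimp only; omega, by dsimp only; omega, by dsimp only; omega⟩,
          by dsimp only; omega⟩, ?_, ?_⟩
        · zify; linarith
        · dsimp only at h2 ⊢
          ext <;> dsimp only <;> omega
    · rintro ⟨c, d⟩ ⟨⟨hc, hd, h4⟩, h3⟩
      dsimp only at hc hd h4 h3 ⊢
      have e3 := formTwoExp_spec hc hd
      split_ifs with h1 h2 h2
      · obtain ⟨k, hk⟩ : ∃ k, (c + d + 1) / 6 = k := ⟨_, rfl⟩
        obtain ⟨m, hm⟩ : ∃ m, k - d / 2 = m := ⟨_, rfl⟩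
        have hc' : c = 2 * m + 4 * k - 1 := by omega
        have hd' : d = 2 * k - 2 * m := by omega
        rw [hk, hm]
        refine ⟨⟨trivial, trivial⟩, ?_, ?_⟩
        · have e1 := pentagonal_spec m
          have e2 := pentagonal_spec k
          zify
          rw [hc', hd'] at e3 ⊢
          linarith
        · ext <;> dsimp only <;> omega
      · dsimp only at h2; omega
      · dsimp only at h2; omega
      · obtain ⟨k, hk⟩ : ∃ k, (-c - d + 1) / 6 = k := ⟨_, rfl⟩
        obtain ⟨m, hm⟩ : ∃ m, k + d / 2 = m := ⟨_, rfl⟩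
        have hc' : c = -(2 * m + 4 * k - 1) := by omega
        have hd' : d = -(2 * k - 2 * m) := by omega
        rw [hk, hm]
        refine ⟨⟨trivial, trivial⟩, ?_, ?_⟩
        · have e1 := pentagonal_spec m
          have e2 := pentagonal_spec k
          zify
          rw [hc', hd'] at e3 ⊢
          linarith
        · ext <;> dsimp only <;> omega
  have h2 : qSum {p : ℤ × ℤ | (p.1 % 2 = 1 ∧ p.2 % 2 = 0 ∧ (p.1 + p.2) % 4 = 1)
      ∧ (p.1 + p.2) % 3 = 0} formTwoExp = 0 := by
    refine qSum_eq_zero_of_involution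
      (fun p => ((p.1 + 4 * p.2) / 3, (2 * p.1 - p.2) / 3)) ?_
    rintro ⟨c, d⟩ ⟨⟨hc, hd, h4⟩, h3⟩
    dsimp only at hc hd h4 h3 ⊢
    obtain ⟨x, hx⟩ : ∃ x, (c + 4 * d) / 3 = x := ⟨_, rfl⟩
    obtain ⟨y, hy⟩ : ∃ y, (2 * c - d) / 3 = y := ⟨_, rfl⟩
    have hxx : 3 * x = c + 4 * d := by omega
    have hyy : 3 * y = 2 * c - d := by omega
    rw [hx, hy]
    refine ⟨⟨⟨by dsimp only; omega, by dsimp only; omega, by dsimp only; omega⟩,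
      by dsimp only; omega⟩, ?_, by ext <;> dsimp only <;> omega, ?_⟩
    · have e1 := formTwoExp_spec hc hd
      have e2 := formTwoExp_spec (c := x) (d := y) (by omega) (by omega)
      have : 9 * (x ^ 2 + 2 * y ^ 2) = 9 * (c ^ 2 + 2 * d ^ 2) := by
        linear_combination (3 * x + c + 4 * d) * hxx + 2 * (3 * y + 2 * c - d) * hyy
      zify; linarith
    · intro h
      simp only [Prod.mk.injEq] at h
      omega
  have h3 : qSum {p : ℤ × ℤ | p.1 % 2 = 1 ∧ p.2 % 2 = 0 ∧ (p.1 + p.2) % 4 = 1} formTwoExp =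
      oddSquares 4 1 := by
    rw [qSum_eq_of_involution (finFib_formTwoExp hR) (fun p => (p.1, -p.2))]
    · refine qSum_congr Prod.fst (fun c => (c, 0)) ?_ ?_
      · rintro ⟨c, d⟩ ⟨⟨hc, hd, h4⟩, h⟩
        simp only [Prod.mk.injEq, true_and] at h
        obtain rfl : d = 0 := by omega
        dsimp only at hc hd h4 ⊢
        refine ⟨by simpa using h4, ?_, rfl⟩
        simp [sqExp, formTwoExp]
      · intro c hc
        simp only [Set.mem_ofPred_eq] at hc
        refine ⟨⟨⟨by dsimp only; omega, by dsimp only; omega, by dsimp only; omega⟩, by simp⟩,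
          ?_, rfl⟩
        simp [sqExp, formTwoExp]
    · rintro ⟨c, d⟩ ⟨hc, hd, h4⟩
      dsimp only at hc hd h4 ⊢
      refine ⟨⟨by dsimp only; omega, by dsimp only; omega, by dsimp only; omega⟩, ?_, by simp⟩
      simp [formTwoExp]
  rw [← h3, split_by_three (finFib_formTwoExp hR)]
  refine h1.trans ?_
  refine (add_zero _).symm.trans ?_
  congr 1
  exact h2.symm

theorem eulerMod_mul_pow_three (j : ℕ) (hj : j ≠ 0) :
    eulerMod j ^ 3 = qSum {c : ℤ | c % 4 = 1} (fun c => j * sqExp c) := by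
  rw [eulerMod_eq_expand j hj, ← map_pow, eulerMod_one_pow_three, oddSquares, expand_qSum]

theorem finFib_sqExp_four : FinFib {c : ℤ | c % 4 = 1} sqExp :=
  finFib_sqExp fun c hc => by simp only [Set.mem_ofPred_eq] at hc; omega

theorem X_mul_eulerMod_five_pow_six : PowerSeries.X * eulerMod 5 ^ 6 =
    qSum {c : ℤ | c % 4 = 1} (fun c => 2 * (5 * sqExp c) + 1) := by
  rw [← qSum_X_pow_mul (e := fun c : ℤ => 2 * (5 * sqExp c)),
    ← qSum_sq (e := fun c : ℤ => 5 * sqExp c) (finFib_sqExp_four.mul_add 5 (by norm_num) 0),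
    ← eulerMod_mul_pow_three 5 (by norm_num)]
  ring

/-- The identity `f_1 * f_5 = f_1 ^ 6 + q * f_5 ^ 6` modulo 2. The exponents on the left are given by
`(6 m - 1) ^ 2 + 5 * (6 k - 1) ^ 2 = 6 * (c ^ 2 + 5 * d ^ 2)`, and the pairs `(c, d)` cancel under
two conjugations as in `eulerMod_one_pow_three`, up to those with `c = 0` or `d = 0`. -/
theorem eulerMod_one_mul_five :
    eulerMod 1 * eulerMod 5 = eulerMod 1 ^ 6 + PowerSeries.X * eulerMod 5 ^ 6 := by
  have hR : ∀ p ∈ {p : ℤ × ℤ | (p.1 + p.2) % 4 = 1}, (p.1 + p.2) % 2 = 1 := fun p hp => by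
    simp only [Set.mem_ofPred_eq] at hp; omega
  have h1 : eulerMod 1 * eulerMod 5 = qSum {p : ℤ × ℤ | (p.1 + p.2) % 4 = 1
      ∧ (p.1 + p.2) % 3 ≠ 0} formFiveExp := by
    rw [eulerMod_eq_expand 5 (by norm_num), eulerMod_one, expand_qSum,
      qSum_mul (f := fun k => 5 * pentagonal k) finFib_pentagonal
        (finFib_pentagonal.mul_add 5 (by norm_num) 0)]
    refine qSum_congr
      (fun p => if (6 * p.2 - 1) % 4 = 1 then (p.1 + 5 * p.2 - 1, p.2 - p.1)
        else (-(p.1 + 5 * p.2 - 1), -(p.2 - p.1)))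
      (fun p => if (p.1 + p.2) % 6 = 5 then ((p.1 + p.2 + 1) / 6 - p.2, (p.1 + p.2 + 1) / 6)
        else ((-p.1 - p.2 + 1) / 6 + p.2, (-p.1 - p.2 + 1) / 6)) ?_ ?_
    · rintro ⟨m, k⟩ -
      have e1 := pentagonal_spec m
      have e2 := pentagonal_spec k
      dsimp only
      split_ifs with h1 h2 h2
      · have e3 := formFiveExp_spec (c := m + 5 * k - 1) (d := k - m) (by omega)
        refine ⟨⟨by dsimp only; omega, by dsimp only; omega⟩, ?_, ?_⟩
        · zify; linarith
        · dsimp only at h2 ⊢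
          ext <;> dsimp only <;> omega
      · dsimp only at h2; omega
      · dsimp only at h2; omega
      · have e3 := formFiveExp_spec (c := -(m + 5 * k - 1)) (d := -(k - m)) (by omega)
        refine ⟨⟨by dsimp only; omega, by dsimp only; omega⟩, ?_, ?_⟩
        · zify; linarith
        · dsimp only at h2 ⊢
          ext <;> dsimp only <;> omega
    · rintro ⟨c, d⟩ ⟨h4, h3⟩
      dsimp only at h4 h3 ⊢
      have e3 := formFiveExp_spec (c := c) (d := d) (by omega)
      split_ifs with h1 h2 h2
      · obtain ⟨k, hk⟩ : ∃ k, (c + d + 1) / 6 = k := ⟨_, rfl⟩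
        obtain ⟨m, hm⟩ : ∃ m, k - d = m := ⟨_, rfl⟩
        have hc' : c = m + 5 * k - 1 := by omega
        have hd' : d = k - m := by omega
        rw [hk, hm]
        refine ⟨⟨trivial, trivial⟩, ?_, ?_⟩
        · have e1 := pentagonal_spec m
          have e2 := pentagonal_spec k
          zify
          rw [hc', hd'] at e3 ⊢
          linarith
        · ext <;> dsimp only <;> omega
      · dsimp only at h2; omega
      · dsimp only at h2; omega
      · obtain ⟨k, hk⟩ : ∃ k, (-c - d + 1) / 6 = k := ⟨_, rfl⟩
        obtain ⟨m, hm⟩ : ∃ m, k + d = m := ⟨_, rfl⟩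
        have hc' : c = -(m + 5 * k - 1) := by omega
        have hd' : d = -(k - m) := by omega
        rw [hk, hm]
        refine ⟨⟨trivial, trivial⟩, ?_, ?_⟩
        · have e1 := pentagonal_spec m
          have e2 := pentagonal_spec k
          zify
          rw [hc', hd'] at e3 ⊢
          linarith
        · ext <;> dsimp only <;> omega
  have h2 : qSum {p : ℤ × ℤ | (p.1 + p.2) % 4 = 1 ∧ (p.1 + p.2) % 3 = 0} formFiveExp = 0 := by
    refine qSum_eq_zero_of_involution
      (fun p => ((2 * p.1 + 5 * p.2) / 3, (p.1 - 2 * p.2) / 3)) ?_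
    rintro ⟨c, d⟩ ⟨h4, h3⟩
    dsimp only at h4 h3 ⊢
    obtain ⟨x, hx⟩ : ∃ x, (2 * c + 5 * d) / 3 = x := ⟨_, rfl⟩
    obtain ⟨y, hy⟩ : ∃ y, (c - 2 * d) / 3 = y := ⟨_, rfl⟩
    have hxx : 3 * x = 2 * c + 5 * d := by omega
    have hyy : 3 * y = c - 2 * d := by omega
    rw [hx, hy]
    refine ⟨⟨by dsimp only; omega, by dsimp only; omega⟩, ?_,
      by ext <;> dsimp only <;> omega, ?_⟩
    · have e1 := formFiveExp_spec (c := c) (d := d) (by omega)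
      have e2 := formFiveExp_spec (c := x) (d := y) (by omega)
      have : 9 * (x ^ 2 + 5 * y ^ 2) = 9 * (c ^ 2 + 5 * d ^ 2) := by
        linear_combination (3 * x + 2 * c + 5 * d) * hxx + 5 * (3 * y + c - 2 * d) * hyy
      zify; linarith
    · intro h
      simp only [Prod.mk.injEq] at h
      omega
  have h3 : qSum {p : ℤ × ℤ | (p.1 + p.2) % 4 = 1} formFiveExp =
      eulerMod 1 ^ 6 + PowerSeries.X * eulerMod 5 ^ 6 := by
    rw [qSum_eq_of_involution (finFib_formFiveExp hR)
      (fun p => if p.2 % 2 = 0 then (p.1, -p.2) else (-p.1, p.2)),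
      show eulerMod 1 ^ 6 = (eulerMod 1 ^ 3) ^ 2 by ring, eulerMod_one_pow_three, oddSquares,
      qSum_sq finFib_sqExp_four, X_mul_eulerMod_five_pow_six]
    · have hs : {x | x ∈ {p : ℤ × ℤ | (p.1 + p.2) % 4 = 1} ∧
          (if x.2 % 2 = 0 then (x.1, -x.2) else (-x.1, x.2)) = x} =
          {p : ℤ × ℤ | p.1 % 4 = 1 ∧ p.2 = 0} ∪ {p : ℤ × ℤ | p.2 % 4 = 1 ∧ p.1 = 0} := by
        ext ⟨c, d⟩
        simp only [Set.mem_ofPred_eq, Set.mem_union]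
        constructor
        · rintro ⟨h4, h⟩
          split_ifs at h <;> simp only [Prod.mk.injEq] at h <;> omega
        · rintro (⟨h4, rfl⟩ | ⟨h4, rfl⟩)
          · simp [h4]
          · refine ⟨by omega, ?_⟩
            rw [if_neg (by omega)]
            simp
      rw [hs, qSum_union]
      · congr 1
        · refine qSum_congr Prod.fst (fun c => (c, 0)) ?_ ?_
          · rintro ⟨c, d⟩ ⟨h4, h⟩
            dsimp only at h4 h ⊢
            subst h
            have e1 := formFiveExp_spec (c := c) (d := 0) (by omega)
            have e2 := sqExp_spec (c := c) (by omega)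
            refine ⟨h4, ?_, rfl⟩
            zify; linarith
          · rintro c h4
            simp only [Set.mem_ofPred_eq] at h4
            have e1 := formFiveExp_spec (c := c) (d := 0) (by omega)
            have e2 := sqExp_spec (c := c) (by omega)
            refine ⟨⟨h4, rfl⟩, ?_, rfl⟩
            zify; linarith
        · refine qSum_congr Prod.snd (fun c => (0, c)) ?_ ?_
          · rintro ⟨c, d⟩ ⟨h4, h⟩
            dsimp only at h4 h ⊢
            subst h
            have e1 := formFiveExp_spec (c := 0) (d := d) (by omega)
            have e2 := sqExp_spec (c := d) (by omega)
            refine ⟨h4, ?_, rfl⟩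
            zify; linarith
          · rintro d h4
            simp only [Set.mem_ofPred_eq] at h4
            have e1 := formFiveExp_spec (c := 0) (d := d) (by omega)
            have e2 := sqExp_spec (c := d) (by omega)
            refine ⟨⟨h4, rfl⟩, ?_, rfl⟩
            zify; linarith
      · exact finFib_formFiveExp fun p hp => by have := hp.1; have := hp.2; omega
      · exact finFib_formFiveExp fun p hp => by have := hp.1; have := hp.2; omega
      · refine Set.disjoint_left.2 fun p h h' => ?_
        have := h.1; have := h'.2; omega
    · rintro ⟨c, d⟩ h4
      simp only [Set.mem_ofPred_eq] at h4 ⊢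
      split_ifs with h1 h2
      · exact ⟨by dsimp only; omega, by simp [formFiveExp], by simp⟩
      · dsimp only at h2; omega
      · exact ⟨by dsimp only; omega, by simp [formFiveExp], by simp⟩
  rw [← h3, split_by_three (finFib_formFiveExp hR)]
  refine h1.trans ?_
  refine (add_zero _).symm.trans ?_
  congr 1
  exact h2.symm

/-! ### A Lambert series and its product with a theta series -/

/-- The exponent `(d * e - 1) / 4`. -/
def lambertExp (p : ℤ × ℤ) : ℕ := ((p.1 * p.2 - 1) / 4).toNat

/-- The pairs of integers `(d, e)` of the same sign with `d ≡ a` and `e ≡ b` modulo 20. -/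
def lambertPairs (a b : ℤ) : Set (ℤ × ℤ) := {p | p.1 % 20 = a ∧ p.2 % 20 = b ∧ 0 < p.1 * p.2}

/-- The series whose coefficient at `q ^ n` is the parity of the number of factorizations
`4 * n + 1 = d * e` over the integers with `d ≡ a` and `e ≡ b` modulo 20. It is used
for `(a, b) = (3, 7)` and `(a, b) = (1, 9)`. -/
noncomputable def lambert (a b : ℤ) : PowerSeries (ZMod 2) := qSum (lambertPairs a b) lambertExp

/-- `∑ q ^ (v ^ 2)` over the integers `v ≡ r` modulo 5. -/
noncomputable def squaresModFive (r : ℤ) : PowerSeries (ZMod 2) :=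
  qSum {v : ℤ | v % 5 = r} (fun v => v.natAbs ^ 2)

theorem lambertExp_spec {d e : ℤ} (hp : 0 < d * e)
    (h : (d % 20 = 3 ∧ e % 20 = 7) ∨ (d % 20 = 1 ∧ e % 20 = 9)) :
    4 * (lambertExp (d, e) : ℤ) + 1 = d * e := by
  have h4 : d * e % 4 = 1 := by
    rw [Int.mul_emod]
    rcases h with ⟨h1, h2⟩ | ⟨h1, h2⟩
    · rw [show d % 4 = 3 by omega, show e % 4 = 3 by omega]; rfl
    · rw [show d % 4 = 1 by omega, show e % 4 = 1 by omega]; rfl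
  simp only [lambertExp]
  omega

/-- The residues of `d`, `e` modulo 20 and of `v` modulo 5 that occur in the two cases of the
argument below. -/
def GoodResidues (a b r : ℤ) : Prop := (a = 3 ∧ b = 7 ∧ r = 1) ∨ (a = 1 ∧ b = 9 ∧ r = 2)

theorem lambertExp_spec' {a b r : ℤ} (h : GoodResidues a b r) {p : ℤ × ℤ}
    (hp : p ∈ lambertPairs a b) : 4 * (lambertExp p : ℤ) + 1 = p.1 * p.2 := by
  obtain ⟨h1, h2, h3⟩ := hp
  exact lambertExp_spec h3 (by rcases h with ⟨h, h', -⟩ | ⟨h, h', -⟩ <;> omega)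

theorem finFib_lambert {a b r : ℤ} (h : GoodResidues a b r) :
    FinFib (lambertPairs a b) lambertExp := by
  intro n
  refine ((Set.finite_Icc (-(4 * n + 1 : ℤ)) (4 * n + 1)).prod
    (Set.finite_Icc (-(4 * n + 1 : ℤ)) (4 * n + 1))).subset ?_
  rintro ⟨d, e⟩ ⟨hp, hn⟩
  have h1 := lambertExp_spec' h hp
  rw [hn] at h1
  dsimp only at h1
  have h2 : d ∣ (4 * n + 1 : ℤ) := ⟨e, h1⟩
  have h3 : e ∣ (4 * n + 1 : ℤ) := ⟨d, by rw [h1, mul_comm]⟩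
  have h4 := abs_le.1 (Int.le_of_dvd (by positivity) ((abs_dvd _ _).2 h2))
  have h5 := abs_le.1 (Int.le_of_dvd (by positivity) ((abs_dvd _ _).2 h3))
  exact ⟨h4, h5⟩

theorem finFib_natAbs_sq (s : Set ℤ) : FinFib s (fun v => v.natAbs ^ 2) := by
  intro n
  refine (Set.finite_Icc (-(n : ℤ)) n).subset ?_
  rintro v ⟨-, hn⟩
  have : v.natAbs ≤ n := by rw [← hn]; exact Nat.le_self_pow two_ne_zero _
  constructor <;> omega

/-- The triples `(d, e, v)` of integers with `d ≡ a`, `e ≡ b` modulo 20, `v ≡ r` modulo 5 and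
`d * e + 4 * v ^ 2 = M`. Such a triple stands for the quadratic form
`d * x ^ 2 + 4 * v * x * y - e * y ^ 2`, whose discriminant is `4 * M`. -/
def formTriples (a b r M : ℤ) : Set (ℤ × ℤ × ℤ) :=
  {t | t.1 % 20 = a ∧ t.2.1 % 20 = b ∧ t.2.2 % 5 = r ∧ t.1 * t.2.1 + 4 * t.2.2 ^ 2 = M}

/-- The value `d + 4 * v - e` of the quadratic form at `(1, 1)`. -/
def formValue (t : ℤ × ℤ × ℤ) : ℤ := t.1 + 4 * t.2.2 - t.2.1

theorem finite_of_bounded {s : Set (ℤ × ℤ × ℤ)} (B : ℤ)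
    (h : ∀ t ∈ s, |t.1| ≤ B ∧ |t.2.1| ≤ B ∧ |t.2.2| ≤ B) : s.Finite := by
  refine ((Set.finite_Icc (-B) B).prod ((Set.finite_Icc (-B) B).prod
    (Set.finite_Icc (-B) B))).subset ?_
  intro t ht
  exact ⟨abs_le.1 (h t ht).1, abs_le.1 (h t ht).2.1, abs_le.1 (h t ht).2.2⟩

theorem abs_le_of_mul {x y B : ℤ} (hy : y ≠ 0) (h : |x * y| ≤ B) : |x| ≤ B := by
  rw [abs_mul] at h
  have := Int.one_le_abs hy
  nlinarith [abs_nonneg x]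

theorem abs_le_of_sq {x B : ℤ} (h : x ^ 2 ≤ B) : |x| ≤ B := by
  rcases abs_cases x with ⟨h1, _⟩ | ⟨h1, _⟩ <;> rw [h1] <;> nlinarith

/-- The forms of `formTriples a b r M` that have opposite signs at `∞ = (1, 0)` and at `0 = (0, 1)`
and do not vanish at `(1, 1)` are even in number. A form that vanishes at none of the three points
changes sign across none or exactly two of the three pairs of points. The forms that change sign
across a pair with `(1, 1)` as a member are finite in number, and they cancel under the
reflection that fixes both points of the pair: the substitution `x ↦ 2 * y - x` for the pair with
`∞`, and `y ↦ 2 * x - y` for the pair with `0`. -/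
theorem even_ncard_crossing {a b r : ℤ} (h : GoodResidues a b r) (M : ℤ) :
    Even {t | t ∈ formTriples a b r M ∧ 0 < t.1 * t.2.1 ∧ formValue t ≠ 0}.ncard := by
  set S := formTriples a b r M with hS
  have hM : ∀ t ∈ S, t.1 * t.2.1 + 4 * t.2.2 ^ 2 = M := fun t ht => ht.2.2.2
  have hd0 : ∀ t ∈ S, t.1 ≠ 0 := fun t ht h0 => by
    have h1 := ht.1
    rcases h with ⟨h, -, -⟩ | ⟨h, -, -⟩ <;> rw [h0, h] at h1 <;> simp at h1
  have he0 : ∀ t ∈ S, t.2.1 ≠ 0 := fun t ht h0 => by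
    have h1 := ht.2.1
    rcases h with ⟨-, h, -⟩ | ⟨-, h, -⟩ <;> rw [h0, h] at h1 <;> simp at h1
  set A := {t | t ∈ S ∧ 0 < t.1 * t.2.1 ∧ formValue t ≠ 0} with hA
  set B := {t | t ∈ S ∧ t.1 * formValue t < 0} with hB
  set C := {t | t ∈ S ∧ 0 < t.2.1 * formValue t} with hC
  have fA : A.Finite := by
    refine finite_of_bounded M ?_
    rintro ⟨d, e, v⟩ ⟨ht, hp, -⟩
    have h1 := hM _ ht
    dsimp only at h1 hp ⊢
    have h2 : |d * e| ≤ M := by rw [abs_of_pos hp]; nlinarith [sq_nonneg v]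
    refine ⟨abs_le_of_mul (he0 _ ht) h2, abs_le_of_mul (hd0 _ ht) (by rwa [mul_comm]),
      abs_le_of_sq (by nlinarith [sq_nonneg v])⟩
  have bound3 : ∀ d e v : ℤ, |d| ≤ |M| → |2 * v + d| ≤ |M| → |d + 4 * v - e| ≤ |M| →
      |d| ≤ 10 * |M| ∧ |e| ≤ 10 * |M| ∧ |v| ≤ 10 * |M| := by
    intro d e v h1 h2 h3
    rw [abs_le] at *
    rw [abs_le, abs_le]
    refine ⟨⟨by linarith, by linarith⟩, ⟨by linarith, by linarith⟩, ⟨by linarith, by linarith⟩⟩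
  have bound4 : ∀ d e v : ℤ, |e| ≤ |M| → |2 * v - e| ≤ |M| → |d + 4 * v - e| ≤ |M| →
      |d| ≤ 10 * |M| ∧ |e| ≤ 10 * |M| ∧ |v| ≤ 10 * |M| := by
    intro d e v h1 h2 h3
    rw [abs_le] at *
    rw [abs_le, abs_le]
    refine ⟨⟨by linarith, by linarith⟩, ⟨by linarith, by linarith⟩, ⟨by linarith, by linarith⟩⟩
  have fB : B.Finite := by
    refine finite_of_bounded (10 * |M|) ?_
    rintro ⟨d, e, v⟩ ⟨ht, hp⟩
    have h1 := hM _ ht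
    simp only [formValue] at h1 hp ⊢
    have h2 : (2 * v + d) ^ 2 = M + d * (d + 4 * v - e) := by linear_combination h1
    have h3 : |d * (d + 4 * v - e)| ≤ |M| := by
      rw [abs_of_neg hp]
      exact le_trans (by nlinarith [sq_nonneg (2 * v + d)]) (le_abs_self M)
    have h4 : d + 4 * v - e ≠ 0 := fun h0 => by rw [h0] at hp; simp at hp
    exact bound3 d e v (abs_le_of_mul h4 h3)
      (abs_le_of_sq (le_trans (by rw [h2]; linarith) (le_abs_self M)))
      (abs_le_of_mul (hd0 _ ht) (by rwa [mul_comm]))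
  have fC : C.Finite := by
    refine finite_of_bounded (10 * |M|) ?_
    rintro ⟨d, e, v⟩ ⟨ht, hp⟩
    have h1 := hM _ ht
    simp only [formValue] at h1 hp ⊢
    have h2 : (2 * v - e) ^ 2 = M - e * (d + 4 * v - e) := by linear_combination h1
    have h3 : |e * (d + 4 * v - e)| ≤ |M| := by
      rw [abs_of_pos hp]
      exact le_trans (by nlinarith [sq_nonneg (2 * v - e)]) (le_abs_self M)
    have h4 : d + 4 * v - e ≠ 0 := fun h0 => by rw [h0] at hp; simp at hp
    exact bound4 d e v (abs_le_of_mul h4 h3)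
      (abs_le_of_sq (le_trans (by rw [h2]; linarith) (le_abs_self M)))
      (abs_le_of_mul (he0 _ ht) (by rwa [mul_comm]))
  -- the reflection that fixes `∞` and `(1, 1)`
  have eB : Even B.ncard := by
    refine ncard_even_of_involution
      (fun t => (t.1, t.2.1 - 8 * t.2.2 - 4 * t.1, -(t.2.2 + t.1))) ?_ ?_ ?_
    · rintro ⟨d, e, v⟩ ⟨⟨h1, h2, h3, h4⟩, h5⟩
      simp only [formValue] at h1 h2 h3 h4 h5 ⊢
      refine ⟨⟨h1, ?_, ?_, ?_⟩, ?_⟩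
      · dsimp only; rcases h with ⟨h, h', h''⟩ | ⟨h, h', h''⟩ <;> subst h <;> subst h' <;>
          subst h'' <;> omega
      · dsimp only; rcases h with ⟨h, h', h''⟩ | ⟨h, h', h''⟩ <;> subst h <;> subst h' <;>
          subst h'' <;> omega
      · dsimp only; linear_combination h4
      · dsimp only [formValue]
        convert h5 using 1
        ring
    · rintro ⟨d, e, v⟩ -
      ext <;> dsimp only <;> ring
    · rintro ⟨d, e, v⟩ ⟨⟨h1, h2, h3, h4⟩, h5⟩ h6
      simp only [Prod.mk.injEq] at h1 h6
      rcases h with ⟨h, h', h''⟩ | ⟨h, h', h''⟩ <;> omega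
  -- the reflection that fixes `0` and `(1, 1)`
  have eC : Even C.ncard := by
    refine ncard_even_of_involution
      (fun t => (t.1 + 8 * t.2.2 - 4 * t.2.1, t.2.1, t.2.1 - t.2.2)) ?_ ?_ ?_
    · rintro ⟨d, e, v⟩ ⟨⟨h1, h2, h3, h4⟩, h5⟩
      simp only [formValue] at h1 h2 h3 h4 h5 ⊢
      refine ⟨⟨?_, h2, ?_, ?_⟩, ?_⟩
      · dsimp only; rcases h with ⟨h, h', h''⟩ | ⟨h, h', h''⟩ <;> subst h <;> subst h' <;>
          subst h'' <;> omega
      · dsimp only; rcases h with ⟨h, h', h''⟩ | ⟨h, h', h''⟩ <;> subst h <;> subst h' <;>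
          subst h'' <;> omega
      · dsimp only; linear_combination h4
      · dsimp only [formValue]
        convert h5 using 1
        ring
    · rintro ⟨d, e, v⟩ -
      ext <;> dsimp only <;> ring
    · rintro ⟨d, e, v⟩ ⟨⟨h1, h2, h3, h4⟩, h5⟩ h6
      simp only [Prod.mk.injEq] at h2 h6
      rcases h with ⟨h, h', h''⟩ | ⟨h, h', h''⟩ <;> omega
  -- every form lies in none or in exactly two of the three sets
  have key : ∀ t ∈ S, (t ∈ A ∧ t ∈ B ∧ t ∉ C) ∨ (t ∈ A ∧ t ∉ B ∧ t ∈ C) ∨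
      (t ∉ A ∧ t ∈ B ∧ t ∈ C) ∨ (t ∉ A ∧ t ∉ B ∧ t ∉ C) := by
    intro t ht
    have h1 := hd0 t ht
    have h2 := he0 t ht
    simp only [hA, hB, hC, Set.mem_ofPred_eq, ht, true_and]
    generalize formValue t = w
    generalize t.1 = d at *
    generalize t.2.1 = e at *
    rcases lt_trichotomy w 0 with hw | hw | hw
    · rcases lt_or_gt_of_ne h1 with hd | hd <;> rcases lt_or_gt_of_ne h2 with he | he <;>
      simp [mul_pos_iff, mul_neg_iff, hw, hd, he, hw.not_gt, hd.not_gt, he.not_gt, hw.ne]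
    · simp [hw]
    · rcases lt_or_gt_of_ne h1 with hd | hd <;> rcases lt_or_gt_of_ne h2 with he | he <;>
      simp [mul_pos_iff, mul_neg_iff, hw, hd, he, hw.not_gt, hd.not_gt, he.not_gt, hw.ne']
  have uA : A = (A ∩ B) ∪ (A ∩ C) := by
    ext t
    simp only [Set.mem_union, Set.mem_inter_iff]
    constructor
    · intro ht; have := key t ht.1; tauto
    · tauto
  have uB : B = (A ∩ B) ∪ (B ∩ C) := by
    ext t
    simp only [Set.mem_union, Set.mem_inter_iff]
    constructor
    · intro ht; have := key t ht.1; tauto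
    · tauto
  have uC : C = (A ∩ C) ∪ (B ∩ C) := by
    ext t
    simp only [Set.mem_union, Set.mem_inter_iff]
    constructor
    · intro ht; have := key t ht.1; tauto
    · tauto
  have nA : A.ncard = (A ∩ B).ncard + (A ∩ C).ncard := by
    conv_lhs => rw [uA]
    refine Set.ncard_union_eq ?_ (fA.inter_of_left _) (fA.inter_of_left _)
    refine Set.disjoint_left.2 fun t h1 h2 => ?_
    have h3 := key t h1.1.1; have := h1.2; have := h2.1; have := h2.2; tauto
  have nB : B.ncard = (A ∩ B).ncard + (B ∩ C).ncard := by
    conv_lhs => rw [uB]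
    refine Set.ncard_union_eq ?_ (fA.inter_of_left _) (fB.inter_of_left _)
    refine Set.disjoint_left.2 fun t h1 h2 => ?_
    have h3 := key t h1.1.1; have := h1.2; have := h1.1; have := h2.2; tauto
  have nC : C.ncard = (A ∩ C).ncard + (B ∩ C).ncard := by
    conv_lhs => rw [uC]
    refine Set.ncard_union_eq ?_ (fA.inter_of_left _) (fB.inter_of_left _)
    refine Set.disjoint_left.2 fun t h1 h2 => ?_
    have h3 := key t h1.1.1; have := h1.2; have := h1.1; have := h2.1; tauto
  rw [Nat.even_iff] at eB eC ⊢
  omega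

theorem residues_of_vanishing {a b r s d : ℤ} (h : GoodResidues a b r) (hs : s % 10 = 5)
    (hd : d % 20 = a) : (2 * s - d) % 20 = b ∧ ((s - d) / 2) % 5 = r ∧ 2 * ((s - d) / 2) = s - d := by
  rcases h with ⟨h, h', h''⟩ | ⟨h, h', h''⟩ <;> omega

/-- The number of forms that vanish at `(1, 1)` is odd when the discriminant is `4 * M` with
`M = (10 * j + 5) ^ 2`: they are determined by `d = a + 20 * k`, with `|k| ≤ j`. -/
theorem ncard_vanishing {a b r : ℤ} (h : GoodResidues a b r) (j : ℕ) :
    {t | t ∈ formTriples a b r ((10 * j + 5) ^ 2) ∧ 0 < t.1 * t.2.1 ∧ formValue t = 0}.ncard =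
      2 * j + 1 := by
  have hI : (Set.Icc (-(j : ℤ)) j).ncard = 2 * j + 1 := by
    rw [← Finset.coe_Icc, Set.ncard_coe_finset, Int.card_Icc]
    omega
  rw [← hI]
  have ha : 0 < a ∧ a < 10 ∧ a % 2 = 1 := by
    rcases h with ⟨h, -, -⟩ | ⟨h, -, -⟩ <;> subst h <;> decide
  have hform : ∀ d e v : ℤ, d + 4 * v - e = 0 → d * e + 4 * v ^ 2 = (10 * j + 5 : ℤ) ^ 2 →
      0 < d * e → (0 < d ∧ d < 20 * j + 10 ∧ 2 * v + d = 10 * j + 5) ∨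
      (d < 0 ∧ -(20 * j + 10) < d ∧ 2 * v + d = -(10 * j + 5)) := by
    intro d e v hw hM hp
    obtain rfl : e = d + 4 * v := by linarith
    have h1 : (2 * v + d) ^ 2 = (10 * j + 5 : ℤ) ^ 2 := by linear_combination hM
    rcases sq_eq_sq_iff_eq_or_eq_neg.1 h1 with h2 | h2 <;>
      rcases mul_pos_iff.1 hp with ⟨h3, h4⟩ | ⟨h3, h4⟩
    · left; refine ⟨h3, by linarith, h2⟩
    · exfalso; have : (0 : ℤ) ≤ j := by positivity
      linarith
    · exfalso; have : (0 : ℤ) ≤ j := by positivity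
      linarith
    · right; refine ⟨h3, by linarith, h2⟩
  refine Set.ncard_congr (fun t _ => (t.1 - a) / 20) ?_ ?_ ?_
  · rintro ⟨d, e, v⟩ ⟨⟨h1, h2, h3, h4⟩, hp, hw⟩
    simp only [formValue] at h1 h2 h3 h4 hp hw ⊢
    rcases hform d e v hw h4 hp with h5 | h5 <;> constructor <;> omega
  · rintro ⟨d, e, v⟩ ⟨d', e', v'⟩ ⟨⟨h1, h2, h3, h4⟩, hp, hw⟩ ⟨⟨h1', h2', h3', h4'⟩, hp', hw'⟩ heq
    simp only [formValue] at h1 h2 h3 h4 hp hw h1' h2' h3' h4' hp' hw' heq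
    obtain rfl : d = d' := by omega
    rcases hform d e v hw h4 hp with h5 | h5 <;> rcases hform d e' v' hw' h4' hp' with h6 | h6 <;>
      (have hv : v = v' := by clear h4 h4' hp hp' hw hw' h2 h2' h3 h3'; omega
       have he : e = e' := by linarith
       rw [hv, he])
  · intro k hk
    obtain ⟨hk1, hk2⟩ := hk
    obtain ⟨d, hd⟩ : ∃ d, d = a + 20 * k := ⟨_, rfl⟩
    obtain ⟨s, hs⟩ : ∃ s : ℤ, s = if 0 < d then 10 * (j : ℤ) + 5 else -(10 * j + 5) := ⟨_, rfl⟩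
    have hs10 : s % 10 = 5 := by split_ifs at hs <;> omega
    have hs2 : s ^ 2 = (10 * j + 5 : ℤ) ^ 2 := by split_ifs at hs <;> subst hs <;> ring
    have hda : d % 20 = a := by omega
    obtain ⟨h1, h2, h3⟩ := residues_of_vanishing h hs10 hda
    refine ⟨(d, 2 * s - d, (s - d) / 2), ⟨⟨hda, h1, h2, ?_⟩, ?_, ?_⟩, ?_⟩
    · dsimp only
      rw [← hs2]
      linear_combination (2 * ((s - d) / 2) + (s - d)) * h3
    · dsimp only
      split_ifs at hs with h0
      · exact mul_pos h0 (by omega)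
      · exact mul_pos_of_neg_of_neg (by omega) (by omega)
    · dsimp only [formValue]
      linear_combination 2 * h3
    · dsimp only; omega

/-- The Lambert series times `∑ q ^ (v ^ 2)`. The coefficient of `q ^ n` counts the forms of
discriminant `4 * (4 * n + 1)` with opposite signs at `∞` and `0`; those that do not vanish at
`(1, 1)` are even in number (`even_ncard_crossing`), and there are others only if `4 * n + 1` is the
square of an odd multiple of 5, when their number is odd (`ncard_vanishing`). By
`X_mul_eulerMod_pow_three` below, the right-hand side is `(q * f_25) ^ 6`. -/
theorem lambert_mul_squares {a b r : ℤ} (h : GoodResidues a b r) :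
    lambert a b * squaresModFive r = oddSquares 20 5 ^ 2 := by
  have f5 : FinFib {c : ℤ | c % 20 = 5} sqExp :=
    finFib_sqExp fun c hc => by simp only [Set.mem_ofPred_eq] at hc; omega
  rw [lambert, squaresModFive, qSum_mul (finFib_lambert h) (finFib_natAbs_sq _), oddSquares,
    qSum_sq f5]
  ext n
  rw [coeff_qSum, coeff_qSum]
  have hL : {p : (ℤ × ℤ) × ℤ | p ∈ lambertPairs a b ×ˢ {v : ℤ | v % 5 = r} ∧
      lambertExp p.1 + p.2.natAbs ^ 2 = n}.ncard =
      {t | t ∈ formTriples a b r (4 * n + 1) ∧ 0 < t.1 * t.2.1}.ncard := by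
    refine Set.ncard_congr (fun p _ => (p.1.1, p.1.2, p.2)) ?_ ?_ ?_
    · rintro ⟨⟨d, e⟩, v⟩ ⟨⟨hp, hv⟩, hn⟩
      have h1 := lambertExp_spec' h hp
      have h2 := Int.natAbs_sq v
      obtain ⟨hp1, hp2, hp3⟩ := hp
      refine ⟨⟨hp1, hp2, hv, ?_⟩, hp3⟩
      dsimp only at h1 hn ⊢
      zify at hn
      rw [sq_abs] at hn
      linarith
    · rintro ⟨⟨d, e⟩, v⟩ ⟨⟨d', e'⟩, v'⟩ - - heq
      simpa [and_assoc] using heq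
    · rintro ⟨d, e, v⟩ ⟨⟨h1, h2, h3, h4⟩, hp⟩
      have h5 := lambertExp_spec' (p := (d, e)) h ⟨h1, h2, hp⟩
      refine ⟨((d, e), v), ⟨⟨⟨h1, h2, hp⟩, h3⟩, ?_⟩, rfl⟩
      dsimp only at h4 h5 ⊢
      zify
      rw [sq_abs]
      linarith
  rw [hL]
  have hfin : {t | t ∈ formTriples a b r (4 * n + 1) ∧ 0 < t.1 * t.2.1}.Finite := by
    refine finite_of_bounded (4 * n + 1) ?_
    rintro ⟨d, e, v⟩ ⟨⟨h1, h2, h3, h4⟩, hp⟩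
    dsimp only at h1 h2 h3 h4 hp ⊢
    have h2 : |d * e| ≤ 4 * n + 1 := by rw [abs_of_pos hp]; nlinarith [sq_nonneg v]
    have hd : d ≠ 0 := fun h0 => by rw [h0] at hp; simp at hp
    have he : e ≠ 0 := fun h0 => by rw [h0] at hp; simp at hp
    exact ⟨abs_le_of_mul he h2, abs_le_of_mul hd (by rwa [mul_comm]),
      abs_le_of_sq (by nlinarith [sq_nonneg v])⟩
  have hsplit : {t | t ∈ formTriples a b r (4 * n + 1) ∧ 0 < t.1 * t.2.1} =
      {t | t ∈ formTriples a b r (4 * n + 1) ∧ 0 < t.1 * t.2.1 ∧ formValue t ≠ 0} ∪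
      {t | t ∈ formTriples a b r (4 * n + 1) ∧ 0 < t.1 * t.2.1 ∧ formValue t = 0} := by
    ext t
    simp only [Set.mem_union, Set.mem_ofPred_eq]
    tauto
  rw [hsplit, Set.ncard_union_eq
    (Set.disjoint_left.2 fun t h1 h2 => h1.2.2 h2.2.2)
    (hfin.subset fun t ht => ⟨ht.1, ht.2.1⟩) (hfin.subset fun t ht => ⟨ht.1, ht.2.1⟩),
    Nat.cast_add, (ZMod.natCast_eq_zero_iff_even).2 (even_ncard_crossing h _), zero_add]
  by_cases hc : ∃ c : ℤ, c % 20 = 5 ∧ c ^ 2 = 4 * n + 1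
  · obtain ⟨c, hc5, hcn⟩ := hc
    have h1 : {i : ℤ | i ∈ {c : ℤ | c % 20 = 5} ∧ 2 * sqExp i = n} = {c} := by
      ext i
      simp only [Set.mem_ofPred_eq, Set.mem_singleton_iff]
      constructor
      · rintro ⟨hi, hn⟩
        have h2 := sqExp_spec (c := i) (by omega)
        have h3 : i ^ 2 = c ^ 2 := by rw [hcn, ← h2, ← hn]; push_cast; ring
        rcases sq_eq_sq_iff_eq_or_eq_neg.1 h3 with h4 | h4 <;> omega
      · rintro rfl
        have h2 := sqExp_spec (c := i) (by omega)
        exact ⟨hc5, by zify; linarith⟩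
    obtain ⟨j, hj⟩ : ∃ j : ℕ, c ^ 2 = (10 * (j : ℤ) + 5) ^ 2 := by
      refine ⟨((|c| - 5) / 10).toNat, ?_⟩
      rw [← sq_abs c]
      congr 1
      rcases abs_cases c with ⟨h, _⟩ | ⟨h, _⟩ <;> rw [h] <;> omega
    rw [h1, ← hcn, hj, ncard_vanishing h, Set.ncard_singleton]
    have h2 : (2 : ZMod 2) = 0 := by decide
    push_cast
    rw [h2]
    simp
  · have h1 : {i : ℤ | i ∈ {c : ℤ | c % 20 = 5} ∧ 2 * sqExp i = n} = ∅ := by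
      ext i
      simp only [Set.mem_ofPred_eq, Set.mem_empty_iff_false, iff_false, not_and]
      intro hi hn
      have h2 := sqExp_spec (c := i) (by omega)
      exact hc ⟨i, hi, by rw [← h2, ← hn]; push_cast; ring⟩
    have h2 : {t | t ∈ formTriples a b r (4 * n + 1) ∧ 0 < t.1 * t.2.1 ∧ formValue t = 0} = ∅ := by
      ext ⟨d, e, v⟩
      simp only [Set.mem_ofPred_eq, Set.mem_empty_iff_false, iff_false, not_and]
      rintro ⟨h1, h2, h3, h4⟩ hp hw
      dsimp only [formValue] at h1 h2 h3 h4 hw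
      obtain rfl : e = d + 4 * v := by linarith
      have hs : (2 * v + d) ^ 2 = 4 * n + 1 := by linear_combination h4
      by_cases h5 : (2 * v + d) % 20 = 5
      · exact hc ⟨_, h5, hs⟩
      · refine hc ⟨-(2 * v + d), ?_, by rw [neg_sq, hs]⟩
        rcases h with ⟨h, h', h''⟩ | ⟨h, h', h''⟩ <;> omega
    rw [h1, h2]
    simp

/-- Rotation by an eighth of a turn, `(2 v, c) ↦ (2 v + c, c - 2 v)`, applied to the exponents. -/
theorem squares_mul_oddSquares_sq {r x y : ℤ} (h : (r = 1 ∧ x = 3 ∧ y = 1) ∨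
    (r = 2 ∧ x = 1 ∧ y = 7)) :
    squaresModFive r * oddSquares 10 x ^ 2 = oddSquares 20 5 * oddSquares 10 y := by
  have f5 : FinFib {c : ℤ | c % 20 = 5} sqExp :=
    finFib_sqExp fun c hc => by simp only [Set.mem_ofPred_eq] at hc; omega
  have fx : FinFib {c : ℤ | c % 10 = x} sqExp :=
    finFib_sqExp fun c hc => by simp only [Set.mem_ofPred_eq] at hc; omega
  have fy : FinFib {c : ℤ | c % 10 = y} sqExp :=
    finFib_sqExp fun c hc => by simp only [Set.mem_ofPred_eq] at hc; omega
  rw [squaresModFive, oddSquares, oddSquares, oddSquares, qSum_sq fx,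
    qSum_mul (f := fun c => 2 * sqExp c) (finFib_natAbs_sq _) (fx.mul_add 2 two_ne_zero 0),
    qSum_mul f5 fy]
  refine qSum_congr
    (fun p => (if (2 * p.1 + p.2) % 20 = 5 then 2 * p.1 + p.2 else -(2 * p.1 + p.2),
      p.2 - 2 * p.1))
    (fun p => if (p.1 - p.2) % 4 = 0 then ((p.1 - p.2) / 4, (p.1 + p.2) / 2)
      else ((-p.1 - p.2) / 4, (-p.1 + p.2) / 2)) ?_ ?_
  · rintro ⟨v, c⟩ ⟨hv, hc⟩
    simp only [Set.mem_ofPred_eq] at hv hc ⊢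
    have e1 := sqExp_spec (c := c) (by omega)
    have e2 := sqExp_spec (c := 2 * v + c) (by omega)
    have e3 := sqExp_spec (c := c - 2 * v) (by omega)
    have hexp : sqExp (2 * v + c) + sqExp (c - 2 * v) = v.natAbs ^ 2 + 2 * sqExp c := by
      zify; rw [sq_abs]; linarith
    split_ifs with h1 h2 h2
    · exact ⟨⟨h1, by dsimp only [Set.mem_ofPred_eq]; omega⟩, hexp,
        by ext <;> dsimp only <;> omega⟩
    · omega
    · omega
    · exact ⟨⟨by simp only [Set.mem_ofPred_eq]; omega, by simp only [Set.mem_ofPred_eq]; omega⟩,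
        by rw [sqExp_neg]; exact hexp, by ext <;> dsimp only <;> omega⟩
  · rintro ⟨S, u⟩ ⟨hS, hu⟩
    simp only [Set.mem_ofPred_eq] at hS hu ⊢
    have e2 := sqExp_spec (c := S) (by omega)
    have e3 := sqExp_spec (c := u) (by omega)
    by_cases h1 : (S - u) % 4 = 0
    · rw [if_pos h1]
      obtain ⟨v, hv⟩ : ∃ v, (S - u) / 4 = v := ⟨_, rfl⟩
      obtain ⟨c, hc⟩ : ∃ c, (S + u) / 2 = c := ⟨_, rfl⟩
      rw [hv, hc]
      have hS' : S = 2 * v + c := by omega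
      have hu' : u = c - 2 * v := by omega
      have e1 := sqExp_spec (c := c) (by omega)
      clear hv hc
      subst hS' hu'
      refine ⟨⟨by simp only [Set.mem_ofPred_eq]; omega, by simp only [Set.mem_ofPred_eq]; omega⟩,
        ?_, ?_⟩
      · zify; rw [sq_abs]; linarith
      · dsimp only; rw [if_pos (by omega)]
    · rw [if_neg h1]
      obtain ⟨v, hv⟩ : ∃ v, (-S - u) / 4 = v := ⟨_, rfl⟩
      obtain ⟨c, hc⟩ : ∃ c, (-S + u) / 2 = c := ⟨_, rfl⟩
      rw [hv, hc]
      have hS' : S = -(2 * v + c) := by omega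
      have hu' : u = c - 2 * v := by omega
      have e1 := sqExp_spec (c := c) (by omega)
      clear hv hc
      subst hS' hu'
      refine ⟨⟨by simp only [Set.mem_ofPred_eq]; omega, by simp only [Set.mem_ofPred_eq]; omega⟩,
        ?_, ?_⟩
      · zify; rw [sq_abs]; linarith
      · dsimp only; rw [if_neg (by omega)]

/-! ### Dissection modulo 5 -/

/-- Only exponents congruent to `r` modulo 5 occur in `f`. -/
def InClass (r : ℕ) (f : PowerSeries (ZMod 2)) : Prop :=
  ∀ n, PowerSeries.coeff n f ≠ 0 → n % 5 = r % 5

theorem InClass.mul {r s : ℕ} {f g : PowerSeries (ZMod 2)} (hf : InClass r f) (hg : InClass s g) :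
    InClass (r + s) (f * g) := by
  intro n hn
  rw [PowerSeries.coeff_mul] at hn
  obtain ⟨⟨i, j⟩, hij, h⟩ := Finset.exists_ne_zero_of_sum_ne_zero hn
  rw [Finset.HasAntidiagonal.mem_antidiagonal] at hij
  have h1 := hf i (left_ne_zero_of_mul h)
  have h2 := hg j (right_ne_zero_of_mul h)
  simp only at hij
  omega

theorem InClass.pow {r : ℕ} {f : PowerSeries (ZMod 2)} (hf : InClass r f) (k : ℕ) :
    InClass (r * k) (f ^ k) := by
  induction k with
  | zero =>
    intro n hn
    rw [pow_zero, PowerSeries.coeff_one] at hn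
    have : n = 0 := by by_contra h; simp [h] at hn
    subst this; simp
  | succ k ih => rw [pow_succ, Nat.mul_succ]; exact ih.mul hf

theorem InClass.add {r : ℕ} {f g : PowerSeries (ZMod 2)} (hf : InClass r f) (hg : InClass r g) :
    InClass r (f + g) := by
  intro n hn
  rw [map_add] at hn
  by_cases h : PowerSeries.coeff n f = 0
  · exact hg n (by simpa [h] using hn)
  · exact hf n h

theorem InClass.congr {r s : ℕ} {f : PowerSeries (ZMod 2)} (hf : InClass r f) (h : r % 5 = s % 5) :
    InClass s f := fun n hn => (hf n hn).trans h

theorem inClass_qSum {ι : Type*} {s : Set ι} {e : ι → ℕ} {r : ℕ} (h : ∀ i ∈ s, e i % 5 = r % 5) :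
    InClass r (qSum s e) := by
  intro n hn
  rw [coeff_qSum] at hn
  have : {i | i ∈ s ∧ e i = n}.Nonempty := by
    by_contra hne
    rw [Set.not_nonempty_iff_eq_empty] at hne
    simp [hne] at hn
  obtain ⟨i, hi, rfl⟩ := this
  exact h i hi

/-- The part of a power series with exponents congruent to `r` modulo 5. -/
noncomputable def classPart (r : ℕ) : PowerSeries (ZMod 2) →+ PowerSeries (ZMod 2) where
  toFun f := PowerSeries.mk fun n => if n % 5 = r % 5 then PowerSeries.coeff n f else 0
  map_zero' := by ext n; simp
  map_add' f g := by
    ext n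
    simp only [PowerSeries.coeff_mk, map_add]
    split_ifs <;> simp

theorem classPart_same {r s : ℕ} {f : PowerSeries (ZMod 2)} (hf : InClass s f)
    (h : r % 5 = s % 5) : classPart r f = f := by
  ext n
  simp only [classPart, AddMonoidHom.coe_mk, ZeroHom.coe_mk, PowerSeries.coeff_mk]
  split_ifs with hn
  · rfl
  · by_contra hne
    exact hn ((hf n (Ne.symm hne)).trans h.symm)

theorem classPart_other {r s : ℕ} {f : PowerSeries (ZMod 2)} (hf : InClass s f)
    (h : r % 5 ≠ s % 5) : classPart r f = 0 := by
  ext n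
  simp only [classPart, AddMonoidHom.coe_mk, ZeroHom.coe_mk, PowerSeries.coeff_mk, map_zero]
  split_ifs with hn
  · by_contra hne
    exact h (hn.symm.trans (hf n hne))
  · rfl

/-- The part of `f_1` with exponents divisible by 5. -/
noncomputable def eulerPartZero : PowerSeries (ZMod 2) :=
  qSum {k : ℤ | k % 5 = 0 ∨ k % 5 = 2} pentagonal

/-- The part of `f_1` with exponents congruent to 2 modulo 5. -/
noncomputable def eulerPartTwo : PowerSeries (ZMod 2) :=
  qSum {k : ℤ | k % 5 = 3 ∨ k % 5 = 4} pentagonal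

theorem pentagonal_mod_five (k : ℤ) :
    ((k % 5 = 0 ∨ k % 5 = 2) ∧ pentagonal k % 5 = 0) ∨ (k % 5 = 1 ∧ pentagonal k % 5 = 1) ∨
      ((k % 5 = 3 ∨ k % 5 = 4) ∧ pentagonal k % 5 = 2) := by
  have h := two_mul_natCast_pentagonal k
  have h2 : (2 * (pentagonal k : ℤ)) % 5 = (k % 5 * ((3 * (k % 5) - 1) % 5)) % 5 := by
    rw [h, Int.mul_emod]
    congr 2
    omega
  have h3 : k % 5 = 0 ∨ k % 5 = 1 ∨ k % 5 = 2 ∨ k % 5 = 3 ∨ k % 5 = 4 := by omega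
  rcases h3 with h3 | h3 | h3 | h3 | h3 <;> rw [h3] at h2 <;> norm_num at h2 <;> omega

theorem inClass_eulerPartZero : InClass 0 eulerPartZero :=
  inClass_qSum fun k hk => by
    rcases pentagonal_mod_five k with h | h | h <;> simp only [Set.mem_ofPred_eq] at hk <;> omega

theorem inClass_eulerPartTwo : InClass 2 eulerPartTwo :=
  inClass_qSum fun k hk => by
    rcases pentagonal_mod_five k with h | h | h <;> simp only [Set.mem_ofPred_eq] at hk <;> omega

theorem X_mul_eulerMod : PowerSeries.X * eulerMod 25 = qSum {k : ℤ | k % 5 = 1} pentagonal := by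
  rw [eulerMod_eq_expand 25 (by norm_num), eulerMod_one, expand_qSum, ← pow_one PowerSeries.X,
    qSum_X_pow_mul]
  refine qSum_congr (fun k => 1 - 5 * k) (fun k => (1 - k) / 5) ?_ ?_
  · intro k _
    have h1 := pentagonal_spec k
    have h2 := pentagonal_spec (1 - 5 * k)
    refine ⟨by simp only [Set.mem_ofPred_eq]; omega, ?_, by omega⟩
    zify; linarith
  · intro k hk
    simp only [Set.mem_ofPred_eq] at hk
    obtain ⟨j, rfl⟩ : ∃ j, k = 1 - 5 * j := ⟨(1 - k) / 5, by omega⟩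
    rw [show (1 - (1 - 5 * j)) / 5 = j by omega]
    have h1 := pentagonal_spec j
    have h2 := pentagonal_spec (1 - 5 * j)
    refine ⟨trivial, ?_, rfl⟩
    zify; linarith

theorem inClass_X_mul_eulerMod : InClass 1 (PowerSeries.X * eulerMod 25) := by
  rw [X_mul_eulerMod]
  exact inClass_qSum fun k hk => by
    rcases pentagonal_mod_five k with h | h | h <;> simp only [Set.mem_ofPred_eq] at hk <;> omega

/-- The 5-dissection of `f_1`, whose parts have exponents in the classes of 0, 1 and 2. -/
theorem eulerMod_one_dissection :
    eulerMod 1 = eulerPartZero + PowerSeries.X * eulerMod 25 + eulerPartTwo := by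
  have hf : ∀ s, FinFib s pentagonal := fun s => finFib_pentagonal.mono (Set.subset_univ s)
  rw [X_mul_eulerMod, eulerMod_one, eulerPartZero, eulerPartTwo, ← qSum_union (hf _) (hf _),
    ← qSum_union (hf _) (hf _)]
  · congr 1
    ext k
    simp only [Set.mem_univ, Set.mem_union, Set.mem_ofPred_eq, true_iff]
    omega
  · refine Set.disjoint_left.2 fun k h1 h2 => ?_
    simp only [Set.mem_union, Set.mem_ofPred_eq] at h1 h2
    omega
  · refine Set.disjoint_left.2 fun k h1 h2 => ?_
    simp only [Set.mem_ofPred_eq] at h1 h2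
    omega

theorem inClass_oddSquares_one : InClass 0 (oddSquares 10 1) := by
  refine inClass_qSum fun c hc => ?_
  simp only [Set.mem_ofPred_eq] at hc
  have h := sqExp_spec (c := c) (by omega)
  obtain ⟨k, rfl⟩ : ∃ k, c = 10 * k + 1 := ⟨c / 10, by omega⟩
  have : (10 * k + 1) ^ 2 = 100 * k ^ 2 + 20 * k + 1 := by ring
  omega

theorem inClass_oddSquares_three : InClass 1 (oddSquares 10 3) := by
  refine inClass_qSum fun c hc => ?_
  simp only [Set.mem_ofPred_eq] at hc
  have h := sqExp_spec (c := c) (by omega)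
  obtain ⟨k, rfl⟩ : ∃ k, c = 10 * k + 3 := ⟨c / 10, by omega⟩
  have : (10 * k + 3) ^ 2 = 100 * k ^ 2 + 60 * k + 9 := by ring
  omega

theorem X_mul_eulerMod_pow_three :
    (PowerSeries.X * eulerMod 25) ^ 3 = oddSquares 20 5 := by
  rw [mul_pow, eulerMod_mul_pow_three 25 (by norm_num), qSum_X_pow_mul, oddSquares]
  refine qSum_congr (fun c => 5 * c) (fun c => c / 5) ?_ ?_
  · intro c hc
    simp only [Set.mem_ofPred_eq] at hc ⊢
    have h1 := sqExp_spec (c := c) (by omega)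
    have h2 := sqExp_spec (c := 5 * c) (by omega)
    exact ⟨by omega, by zify; linarith, by omega⟩
  · intro c hc
    simp only [Set.mem_ofPred_eq] at hc ⊢
    obtain ⟨d, rfl⟩ : ∃ d, c = 5 * d := ⟨c / 5, by omega⟩
    rw [show 5 * d / 5 = d by omega]
    have h1 := sqExp_spec (c := d) (by omega)
    have h2 := sqExp_spec (c := 5 * d) (by omega)
    exact ⟨by omega, by zify; linarith, rfl⟩

theorem oddSquares_ten_neg : oddSquares 10 7 = oddSquares 10 3 := by
  refine qSum_congr (fun c => -c) (fun c => -c) ?_ ?_ <;>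
  · intro c hc
    simp only [Set.mem_ofPred_eq] at hc ⊢
    exact ⟨by omega, sqExp_neg c, by omega⟩

/-- The 5-dissection of `f_1 ^ 3`, whose parts have exponents in the classes of 0, 1 and 3. -/
theorem oddSquares_dissection :
    oddSquares 4 1 = oddSquares 10 1 + oddSquares 10 3 + oddSquares 20 5 := by
  have h1 : FinFib {c : ℤ | c % 10 = 1} sqExp :=
    finFib_sqExp fun c hc => by simp only [Set.mem_ofPred_eq] at hc; omega
  have h2 : FinFib {c : ℤ | c % 10 = 3} sqExp :=
    finFib_sqExp fun c hc => by simp only [Set.mem_ofPred_eq] at hc; omega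
  have h3 : FinFib {c : ℤ | c % 20 = 5} sqExp :=
    finFib_sqExp fun c hc => by simp only [Set.mem_ofPred_eq] at hc; omega
  have h12 : FinFib ({c : ℤ | c % 10 = 1} ∪ {c : ℤ | c % 10 = 3}) sqExp :=
    finFib_sqExp fun c hc => by simp only [Set.mem_union, Set.mem_ofPred_eq] at hc; omega
  rw [oddSquares, oddSquares, oddSquares, oddSquares, ← qSum_union h1 h2, ← qSum_union h12 h3]
  · refine qSum_congr
      (fun c => if c % 10 = 1 ∨ c % 10 = 3 ∨ c % 20 = 5 then c else -c)
      (fun c => if c % 4 = 1 then c else -c) ?_ ?_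
    · intro c hc
      simp only [Set.mem_ofPred_eq, Set.mem_union] at hc ⊢
      by_cases h : c % 10 = 1 ∨ c % 10 = 3 ∨ c % 20 = 5
      · rw [if_pos h]
        exact ⟨by omega, rfl, if_pos hc⟩
      · rw [if_neg h]
        have h20 : c % 20 = 9 ∨ c % 20 = 17 := by omega
        exact ⟨by omega, sqExp_neg c, by rw [if_neg (by omega)]; omega⟩
    · intro c hc
      simp only [Set.mem_ofPred_eq, Set.mem_union] at hc ⊢
      by_cases h : c % 4 = 1
      · rw [if_pos h]
        exact ⟨h, rfl, if_pos (by omega)⟩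
      · rw [if_neg h]
        exact ⟨by omega, sqExp_neg c, by rw [if_neg (by omega)]; omega⟩
  · refine Set.disjoint_left.2 fun k h1 h2 => ?_
    simp only [Set.mem_union, Set.mem_ofPred_eq] at h1 h2
    omega
  · refine Set.disjoint_left.2 fun k h1 h2 => ?_
    simp only [Set.mem_ofPred_eq] at h1 h2
    omega

theorem constantCoeff_eulerMod {j : ℕ} (hj : 0 < j) :
    PowerSeries.constantCoeff (eulerMod j) = 1 := by
  rw [eulerMod, ← PowerSeries.coeff_zero_eq_constantCoeff_apply, PowerSeries.coeff_map,
    PowerSeries.coeff_zero_eq_constantCoeff_apply, constantCoeff_eulerF hj]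
  simp

theorem eulerMod_ne_zero {j : ℕ} (hj : 0 < j) : eulerMod j ≠ 0 := fun h => by
  have := constantCoeff_eulerMod hj
  simp [h] at this

/-- The cube of the 5-dissection of `f_1`, compared with the 5-dissection of `f_1 ^ 3`. The
relation between the two parts of `f_1` comes from the class of 2, which contains no exponent
of `f_1 ^ 3`. -/
theorem eulerPart_relations :
    eulerPartZero * eulerPartTwo = (PowerSeries.X * eulerMod 25) ^ 2 ∧
    oddSquares 10 1 = eulerPartZero ^ 3 + eulerPartTwo ^ 2 * (PowerSeries.X * eulerMod 25) ∧
    oddSquares 10 3 = eulerPartTwo ^ 3 + eulerPartZero ^ 2 * (PowerSeries.X * eulerMod 25) := by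
  have ha := inClass_eulerPartZero
  have hb := inClass_eulerPartTwo
  have hk := inClass_X_mul_eulerMod
  have ht0 := inClass_oddSquares_one
  have ht1 := inClass_oddSquares_three
  have ha0 : eulerPartZero ≠ 0 := fun h0 => by
    have h1 := constantCoeff_eulerMod one_pos
    rw [eulerMod_one_dissection, h0, zero_add, map_add] at h1
    have h3 : PowerSeries.coeff 0 eulerPartTwo = 0 := by
      by_contra hne
      exact absurd (hb 0 hne) (by decide)
    rw [PowerSeries.coeff_zero_eq_constantCoeff_apply] at h3
    simp [h3] at h1
  have hF := eulerMod_one_pow_three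
  rw [oddSquares_dissection, eulerMod_one_dissection, ← X_mul_eulerMod_pow_three] at hF
  generalize eulerPartZero = a at *
  generalize eulerPartTwo = b at *
  generalize PowerSeries.X * eulerMod 25 = k at *
  generalize oddSquares 10 1 = t0 at *
  generalize oddSquares 10 3 = t1 at *
  have h2 := two_eq_zero_series
  have e : (a ^ 3 + b ^ 2 * k) + (b ^ 3 + a ^ 2 * k) + (a * k ^ 2 + a ^ 2 * b) + k ^ 3 +
      (b * k ^ 2 + a * b ^ 2) = t0 + t1 + k ^ 3 := by
    rw [← hF]
    linear_combination -(a * b * k * 3 + a ^ 2 * b + a * b ^ 2 + a ^ 2 * k + a * k ^ 2 +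
      b ^ 2 * k + b * k ^ 2) * h2
  have c0 : InClass 0 (a ^ 3 + b ^ 2 * k) := ((ha.pow 3).congr rfl).add
    (((hb.pow 2).mul hk).congr rfl)
  have c1 : InClass 1 (b ^ 3 + a ^ 2 * k) := ((hb.pow 3).congr rfl).add
    (((ha.pow 2).mul hk).congr rfl)
  have c2 : InClass 2 (a * k ^ 2 + a ^ 2 * b) := ((ha.mul (hk.pow 2)).congr rfl).add
    (((ha.pow 2).mul hb).congr rfl)
  have c3 : InClass 3 (k ^ 3) := (hk.pow 3).congr rfl
  have c4 : InClass 4 (b * k ^ 2 + a * b ^ 2) := ((hb.mul (hk.pow 2)).congr rfl).add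
    ((ha.mul (hb.pow 2)).congr rfl)
  have parts : ∀ r, classPart r (a ^ 3 + b ^ 2 * k) + classPart r (b ^ 3 + a ^ 2 * k) +
      classPart r (a * k ^ 2 + a ^ 2 * b) + classPart r (k ^ 3) +
      classPart r (b * k ^ 2 + a * b ^ 2) =
      classPart r t0 + classPart r t1 + classPart r (k ^ 3) := fun r => by
    simp only [← map_add]; rw [e]
  have p0 := parts 0
  rw [classPart_same c0 rfl, classPart_other c1 (by decide), classPart_other c2 (by decide),
    classPart_other c3 (by decide), classPart_other c4 (by decide), classPart_same ht0 rfl,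
    classPart_other ht1 (by decide)] at p0
  have p1 := parts 1
  rw [classPart_same c1 rfl, classPart_other c0 (by decide), classPart_other c2 (by decide),
    classPart_other c3 (by decide), classPart_other c4 (by decide), classPart_same ht1 rfl,
    classPart_other ht0 (by decide)] at p1
  have p2 := parts 2
  rw [classPart_same c2 rfl, classPart_other c0 (by decide), classPart_other c1 (by decide),
    classPart_other c3 (by decide), classPart_other c4 (by decide), classPart_other ht0 (by decide),
    classPart_other ht1 (by decide)] at p2
  simp only [add_zero, zero_add] at p0 p1 p2
  refine ⟨?_, p0.symm, p1.symm⟩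
  have q : k ^ 2 + a * b = 0 := by
    have : a * (k ^ 2 + a * b) = 0 := by rw [← p2]; ring
    exact (mul_eq_zero.1 this).resolve_left ha0
  linear_combination q - k ^ 2 * h2

theorem oddSquares_ten_ne_zero {r : ℤ} (hr : r = 1 ∨ r = 3) : oddSquares 10 r ≠ 0 := by
  intro h
  have h1 : PowerSeries.coeff (sqExp r) (oddSquares 10 r) = 0 := by rw [h, map_zero]
  rw [oddSquares, coeff_qSum, show {c : ℤ | c ∈ {c : ℤ | c % 10 = r} ∧ sqExp c = sqExp r} = {r}
    from ?_, Set.ncard_singleton] at h1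
  · simp at h1
  · ext c
    simp only [Set.mem_ofPred_eq, Set.mem_singleton_iff]
    constructor
    · rintro ⟨hc, he⟩
      have h2 := sqExp_spec (c := c) (by omega)
      have h3 := sqExp_spec (c := r) (by omega)
      rw [he, h3] at h2
      rcases sq_eq_sq_iff_eq_or_eq_neg.1 h2 with h4 | h4 <;> omega
    · rintro rfl
      exact ⟨by omega, rfl⟩

/-- The Lambert series in terms of `f_1` and `q * f_25`. Elimination of `∑ q ^ (v ^ 2)` between
`lambert_mul_squares` and `squares_mul_oddSquares_sq` expresses each of the two Lambert series
through the parts of `f_1` modulo 5, and the sum of the two through `f_1` itself. -/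
theorem lambert_add_lambert :
    lambert 3 7 + lambert 1 9 = eulerMod 1 * (PowerSeries.X * eulerMod 25) ^ 5 +
      eulerMod 1 ^ 4 * (PowerSeries.X * eulerMod 25) ^ 2 := by
  obtain ⟨hab, ht0, ht1⟩ := eulerPart_relations
  have hk0 : PowerSeries.X * eulerMod 25 ≠ 0 :=
    mul_ne_zero PowerSeries.X_ne_zero (eulerMod_ne_zero (by norm_num))
  have z1 := lambert_mul_squares (a := 3) (b := 7) (r := 1) (by simp [GoodResidues])
  have z2 := lambert_mul_squares (a := 1) (b := 9) (r := 2) (by simp [GoodResidues])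
  have s1 := squares_mul_oddSquares_sq (r := 1) (x := 3) (y := 1) (by simp)
  have s2 := squares_mul_oddSquares_sq (r := 2) (x := 1) (y := 7) (by simp)
  have n0 := oddSquares_ten_ne_zero (r := 1) (by simp)
  have n1 := oddSquares_ten_ne_zero (r := 3) (by simp)
  rw [oddSquares_ten_neg] at s2
  rw [← X_mul_eulerMod_pow_three] at z1 z2 s1 s2
  rw [eulerMod_one_dissection]
  generalize eulerPartZero = a at *
  generalize eulerPartTwo = b at *
  generalize PowerSeries.X * eulerMod 25 = k at *
  generalize oddSquares 10 1 = t0 at *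
  generalize oddSquares 10 3 = t1 at *
  have h2 := two_eq_zero_series
  have l1 : lambert 3 7 = a * k ^ 5 + b ^ 4 * k ^ 2 := by
    refine mul_right_cancel₀ (mul_ne_zero n0 (pow_ne_zero 3 hk0)) ?_
    have : lambert 3 7 * (t0 * k ^ 3) = k ^ 6 * t1 ^ 2 := by
      linear_combination t1 ^ 2 * z1 - lambert 3 7 * s1
    rw [this, ht0, ht1]
    linear_combination -(k ^ 3 * (a * b ^ 2 * k ^ 2) * (a * b + k ^ 2)) * hab +
      k ^ 3 * (a ^ 2 * b ^ 3 * k ^ 4 - a * b ^ 2 * k ^ 6) * h2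
  have l2 : lambert 1 9 = b * k ^ 5 + a ^ 4 * k ^ 2 := by
    refine mul_right_cancel₀ (mul_ne_zero n1 (pow_ne_zero 3 hk0)) ?_
    have : lambert 1 9 * (t1 * k ^ 3) = k ^ 6 * t0 ^ 2 := by
      linear_combination t0 ^ 2 * z2 - lambert 1 9 * s2
    rw [this, ht0, ht1]
    linear_combination -(k ^ 3 * (b * a ^ 2 * k ^ 2) * (a * b + k ^ 2)) * hab +
      k ^ 3 * (b ^ 2 * a ^ 3 * k ^ 4 - b * a ^ 2 * k ^ 6) * h2
  rw [l1, l2]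
  linear_combination -(k ^ 6 + k ^ 2 * (a ^ 2 * k ^ 2 + a ^ 2 * b ^ 2 + k ^ 2 * b ^ 2 +
    2 * (a * k + a * b + k * b) * (a ^ 2 + k ^ 2 + b ^ 2) + 2 * (a * k + a * b + k * b) ^ 2)) * h2

/-! ### Dissection modulo 2 -/

/-- The series `∑ a (2 * n + r) * q ^ n`. -/
noncomputable def section2 (r : ℕ) (f : PowerSeries (ZMod 2)) : PowerSeries (ZMod 2) :=
  PowerSeries.mk fun n => PowerSeries.coeff (2 * n + r) f

theorem coeff_section2 (r n : ℕ) (f : PowerSeries (ZMod 2)) :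
    PowerSeries.coeff n (section2 r f) = PowerSeries.coeff (2 * n + r) f := by
  simp [section2]

/-- In characteristic 2, squaring a power series amounts to the substitution `q ↦ q ^ 2`. -/
theorem sq_eq_expand (f : PowerSeries (ZMod 2)) :
    f ^ 2 = PowerSeries.expand 2 two_ne_zero f := by
  have h : f = qSum {n | PowerSeries.coeff n f ≠ 0} id := by
    ext n
    rw [coeff_qSum]
    by_cases hn : PowerSeries.coeff n f = 0
    · rw [show {i | i ∈ {n | PowerSeries.coeff n f ≠ 0} ∧ id i = n} = ∅ from ?_]
      · simp [hn]
      · ext i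
        simp only [id, Set.mem_ofPred_eq, Set.mem_empty_iff_false, iff_false, not_and]
        rintro hi rfl
        exact hi hn
    · rw [show {i | i ∈ {n | PowerSeries.coeff n f ≠ 0} ∧ id i = n} = {n} from ?_]
      · have : ∀ x : ZMod 2, x ≠ 0 → x = 1 := by decide
        simp [this _ hn]
      · ext i
        simp only [id, Set.mem_ofPred_eq, Set.mem_singleton_iff]
        constructor
        · exact fun h => h.2
        · rintro rfl
          exact ⟨hn, rfl⟩
  rw [h, qSum_sq (FinFib.of_injective Function.injective_id.injOn), expand_qSum]

theorem section2_zero_of_eq {f a b : PowerSeries (ZMod 2)}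
    (h : f = a ^ 2 + PowerSeries.X * b ^ 2) : section2 0 f = a := by
  ext n
  rw [coeff_section2, h, map_add, sq_eq_expand, sq_eq_expand, add_zero, PowerSeries.coeff_expand,
    if_pos (dvd_mul_right _ _), Nat.mul_div_cancel_left _ two_pos]
  rcases n with _ | n
  · simp
  · rw [show 2 * (n + 1) = (2 * n + 1) + 1 by ring, PowerSeries.coeff_succ_X_mul,
      PowerSeries.coeff_expand, if_neg (by omega), add_zero]

theorem section2_one_of_eq {f a b : PowerSeries (ZMod 2)}
    (h : f = a ^ 2 + PowerSeries.X * b ^ 2) : section2 1 f = b := by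
  ext n
  rw [coeff_section2, h, map_add, sq_eq_expand, sq_eq_expand, PowerSeries.coeff_expand,
    if_neg (by omega), PowerSeries.coeff_succ_X_mul, PowerSeries.coeff_expand,
    if_pos (dvd_mul_right _ _), Nat.mul_div_cancel_left _ two_pos, zero_add]

/-- The generating function `f_25 / f_1` modulo 2. -/
noncomputable def regularMod : PowerSeries (ZMod 2) :=
  PowerSeries.map (Int.castRingHom (ZMod 2)) (regularGF 25)

theorem coeff_regularMod (n : ℕ) : PowerSeries.coeff n regularMod = (regularB 25 n : ZMod 2) := by
  simp [regularMod, regularB]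

theorem regularMod_mul : regularMod * eulerMod 1 = eulerMod 25 := by
  rw [regularMod, eulerMod, ← map_mul, regularGF_mul_eulerF_one, eulerMod]

theorem exists_inverse_eulerMod {j : ℕ} (hj : 0 < j) : ∃ g, eulerMod j * g = 1 := by
  refine ⟨PowerSeries.invOfUnit (eulerMod j) 1, PowerSeries.mul_invOfUnit _ _ ?_⟩
  simp [constantCoeff_eulerMod hj]

theorem eulerMod_five_mul_twentyfive :
    eulerMod 5 * eulerMod 25 = eulerMod 5 ^ 6 + PowerSeries.X ^ 5 * eulerMod 25 ^ 6 := by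
  have h := congrArg (PowerSeries.expand 5 (by norm_num)) eulerMod_one_mul_five
  rw [map_mul, map_add, map_mul, map_pow, map_pow, PowerSeries.expand_X,
    ← eulerMod_eq_expand] at h
  have h25 : PowerSeries.expand 5 (by norm_num) (eulerMod 5) = eulerMod 25 := by
    rw [eulerMod_eq_expand 5 (by norm_num), eulerMod_eq_expand 25 (by norm_num),
      ← PowerSeries.expand_mul]
  rwa [h25] at h

section

-- `F`, `G` and `H` are `f_1`, `f_5` and `f_25` modulo 2.
local notation "F" => eulerMod 1
local notation "G" => eulerMod 5
local notation "H" => eulerMod 25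
local notation "q" => (PowerSeries.X : PowerSeries (ZMod 2))

theorem eulerMod_five_div_one {i : PowerSeries (ZMod 2)} (hi : F * i = 1) :
    G * i = (F ^ 2) ^ 2 + q * (G ^ 3 * i) ^ 2 := by
  linear_combination i ^ 2 * eulerMod_one_mul_five + (-(G * i) + F ^ 4 * (F * i + 1)) * hi

theorem eulerMod_twentyfive_div_five {j : PowerSeries (ZMod 2)} (hj : G * j = 1) :
    H * j = (G ^ 2) ^ 2 + q * (q ^ 2 * H ^ 3 * j) ^ 2 := by
  linear_combination j ^ 2 * eulerMod_five_mul_twentyfive +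
    (-(H * j) + G ^ 4 * (G * j + 1)) * hj

theorem eulerMod_five_mul_add : G * (F + q * H) = F ^ 6 + (q * H) ^ 6 := by
  linear_combination eulerMod_one_mul_five + q * eulerMod_five_mul_twentyfive +
    q * G ^ 6 * two_eq_zero_series

/-- The quotient of `F ^ 6 + (q * H) ^ 6` by `F + q * H`. -/
theorem eulerMod_five_eq : G = F ^ 5 + F ^ 4 * (q * H) + F ^ 3 * (q * H) ^ 2 +
    F ^ 2 * (q * H) ^ 3 + F * (q * H) ^ 4 + (q * H) ^ 5 := by
  have h0 : F + q * H ≠ 0 := fun h => by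
    have := congrArg PowerSeries.constantCoeff h
    simp [constantCoeff_eulerMod] at this
  refine mul_right_cancel₀ h0 ?_
  linear_combination eulerMod_five_mul_add - (F ^ 5 * (q * H) + F ^ 4 * (q * H) ^ 2 +
    F ^ 3 * (q * H) ^ 3 + F ^ 2 * (q * H) ^ 4 + F * (q * H) ^ 5) * two_eq_zero_series

theorem regularMod_eq {i : PowerSeries (ZMod 2)} (hi : F * i = 1) : regularMod = H * i := by
  linear_combination i * regularMod_mul - regularMod * hi

/-- The 2-dissection of `f_25 / f_1 = (f_5 / f_1) * (f_25 / f_5)`. -/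
theorem regularMod_dissection {i j : PowerSeries (ZMod 2)} (hi : F * i = 1) (hj : G * j = 1) :
    regularMod = (F ^ 2 * G ^ 2 + q ^ 3 * G ^ 2 * H ^ 3 * i) ^ 2 +
      q * (G ^ 5 * i + q ^ 2 * F ^ 2 * H ^ 3 * j) ^ 2 := by
  have h : regularMod = (G * i) * (H * j) := by
    rw [regularMod_eq hi]
    linear_combination -(H * i) * hj
  rw [h, eulerMod_five_div_one hi, eulerMod_twentyfive_div_five hj]
  linear_combination q ^ 6 * H ^ 6 * i ^ 2 * G ^ 4 * (G * j + 1) * hj -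
    (F ^ 2 * G ^ 2 * q ^ 3 * G ^ 2 * H ^ 3 * i + q * G ^ 5 * i * q ^ 2 * F ^ 2 * H ^ 3 * j) *
      two_eq_zero_series

/-- The 2-dissection of the odd part of `f_25 / f_1`. -/
theorem section_odd_dissection {i j : PowerSeries (ZMod 2)} (hi : F * i = 1) (hj : G * j = 1) :
    G ^ 5 * i + q ^ 2 * F ^ 2 * H ^ 3 * j = (G ^ 2 * F ^ 2 + q * F * H * G ^ 2) ^ 2 +
      q * (G ^ 5 * i + q ^ 3 * F * H ^ 4 * j) ^ 2 := by
  linear_combination G ^ 4 * eulerMod_five_div_one hi +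
    q ^ 2 * F ^ 2 * H ^ 2 * eulerMod_twentyfive_div_five hj -
    (G ^ 2 * F ^ 2 * q * F * H * G ^ 2 + q * G ^ 5 * i * q ^ 3 * F * H ^ 4 * j) *
      two_eq_zero_series

/-- The sequence `b_25 (4 * n)` modulo 2. -/
theorem regularMod_four_mul : section2 0 (section2 0 regularMod) =
    F ^ 6 + (q * G ^ 6 + (q * H) ^ 6) + F ^ 3 * (q * H) ^ 3 + (lambert 3 7 + lambert 1 9) := by
  obtain ⟨i, hi⟩ := exists_inverse_eulerMod one_pos
  obtain ⟨j, hj⟩ := exists_inverse_eulerMod (j := 5) (by norm_num)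
  have h1 := regularMod_dissection hi hj
  have h2 := two_eq_zero_series
  rw [section2_zero_of_eq h1, section2_zero_of_eq
    (a := F * G + q ^ 2 * G * H * (G ^ 5 * i + q ^ 2 * F ^ 2 * H ^ 3 * j))
    (b := q * G * H * (F ^ 2 * G ^ 2 + q ^ 3 * G ^ 2 * H ^ 3 * i)), lambert_add_lambert]
  · linear_combination (-q * H * i) * eulerMod_one_mul_five + q ^ 4 * F ^ 2 * H ^ 4 * hj +
      (q * H * G - q * H * F ^ 5) * hi + F * eulerMod_five_eq +
      q * eulerMod_five_mul_twentyfive + F ^ 2 * q ^ 4 * H ^ 4 * h2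
  · rw [regularMod_eq hi] at h1
    linear_combination q ^ 3 * G ^ 2 * H ^ 2 * h1 -
      F * G * q ^ 2 * G * H * (G ^ 5 * i + q ^ 2 * F ^ 2 * H ^ 3 * j) * h2

/-- The sequence `b_25 (4 * n + 1)` modulo 2. -/
theorem regularMod_four_mul_add_one : section2 0 (section2 1 regularMod) =
    (F ^ 6 + (q * H) ^ 6) * (F ^ 6 + q * G ^ 6) := by
  obtain ⟨i, hi⟩ := exists_inverse_eulerMod one_pos
  obtain ⟨j, hj⟩ := exists_inverse_eulerMod (j := 5) (by norm_num)
  rw [section2_one_of_eq (regularMod_dissection hi hj),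
    section2_zero_of_eq (section_odd_dissection hi hj), ← eulerMod_five_mul_add,
    ← eulerMod_one_mul_five]
  ring

/-- The sequence `b_25 (8 * n + 3)` modulo 2. -/
theorem regularMod_eight_mul_add_three : section2 0 (section2 1 (section2 1 regularMod)) =
    F ^ 12 + (q * H) ^ 12 := by
  obtain ⟨i, hi⟩ := exists_inverse_eulerMod one_pos
  obtain ⟨j, hj⟩ := exists_inverse_eulerMod (j := 5) (by norm_num)
  have h2 := two_eq_zero_series
  rw [section2_one_of_eq (regularMod_dissection hi hj),
    section2_one_of_eq (section_odd_dissection hi hj), section2_zero_of_eq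
    (a := G ^ 2 * F ^ 2 + q ^ 2 * H ^ 2 * G ^ 2) (b := G ^ 5 * i + q * H ^ 2 * F ^ 3 * j)]
  · linear_combination (G * (F + q * H) + F ^ 6 + (q * H) ^ 6) * eulerMod_five_mul_add +
      (F ^ 6 * (q * H) ^ 6 - G ^ 2 * F * q * H) * h2
  · have h3 : F * j = F ^ 6 * j ^ 2 + q * G ^ 4 := by
      linear_combination j ^ 2 * eulerMod_one_mul_five + (-(F * j) + q * G ^ 4 * (G * j + 1)) * hj
    linear_combination G ^ 4 * eulerMod_five_div_one hi + q ^ 3 * H ^ 4 * h3 -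
      (G ^ 2 * F ^ 2 * q ^ 2 * H ^ 2 * G ^ 2 + q * G ^ 5 * i * q * H ^ 2 * F ^ 3 * j) * h2

/-- The sequence `b_25 (8 * n + 2)` modulo 2. -/
theorem regularMod_eight_mul_add_two : section2 0 (section2 1 (section2 0 regularMod)) =
    G * (q * H) ^ 2 * (F ^ 2 + F * (q * H)) := by
  obtain ⟨i, hi⟩ := exists_inverse_eulerMod one_pos
  obtain ⟨j, hj⟩ := exists_inverse_eulerMod (j := 5) (by norm_num)
  have h1 := regularMod_dissection hi hj
  have h2 := two_eq_zero_series
  rw [section2_zero_of_eq h1, section2_one_of_eq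
    (a := F * G + q ^ 2 * G * H * (G ^ 5 * i + q ^ 2 * F ^ 2 * H ^ 3 * j))
    (b := q * G * H * (F ^ 2 * G ^ 2 + q ^ 3 * G ^ 2 * H ^ 3 * i)),
    section2_zero_of_eq (a := G * (q * H) ^ 2 * (F ^ 2 + F * (q * H)))
      (b := F * G ^ 4 + q ^ 2 * G ^ 4 * H ^ 2 * i)]
  · linear_combination q * F ^ 2 * G ^ 2 * eulerMod_five_mul_twentyfive +
      q ^ 4 * G ^ 2 * H ^ 4 * eulerMod_five_div_one hi -
      (G ^ 2 * (q * H) ^ 4 * F ^ 3 * (q * H) + q * F * G ^ 4 * q ^ 2 * G ^ 4 * H ^ 2 * i) * h2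
  · rw [regularMod_eq hi] at h1
    linear_combination q ^ 3 * G ^ 2 * H ^ 2 * h1 -
      F * G * q ^ 2 * G * H * (G ^ 5 * i + q ^ 2 * F ^ 2 * H ^ 3 * j) * h2

end

/-! ### Vanishing of coefficients -/

theorem exists_of_coeff_qSum_ne_zero {ι : Type*} {s : Set ι} {e : ι → ℕ} {n : ℕ}
    (h : PowerSeries.coeff n (qSum s e) ≠ 0) : ∃ i ∈ s, e i = n := by
  rw [coeff_qSum] at h
  by_contra hne
  push Not at hne
  refine h ?_
  rw [show {i | i ∈ s ∧ e i = n} = ∅ from ?_]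
  · simp
  · ext i
    simp only [Set.mem_ofPred_eq, Set.mem_empty_iff_false, iff_false, not_and]
    exact hne i

theorem exists_of_coeff_mul_ne_zero {f g : PowerSeries (ZMod 2)} {n : ℕ}
    (h : PowerSeries.coeff n (f * g) ≠ 0) :
    ∃ i j, i + j = n ∧ PowerSeries.coeff i f ≠ 0 ∧ PowerSeries.coeff j g ≠ 0 := by
  rw [PowerSeries.coeff_mul] at h
  obtain ⟨⟨i, j⟩, hij, h⟩ := Finset.exists_ne_zero_of_sum_ne_zero h
  rw [Finset.HasAntidiagonal.mem_antidiagonal] at hij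
  exact ⟨i, j, hij, left_ne_zero_of_mul h, right_ne_zero_of_mul h⟩

theorem even_regularB_iff (n : ℕ) :
    Even (regularB 25 n) ↔ PowerSeries.coeff n regularMod = 0 := by
  rw [coeff_regularMod, ZMod.intCast_eq_zero_iff_even]

/-- If `D` is a square modulo a prime `p ≡ 3` modulo 4, then `-D` is not, and `p` cannot exactly
divide a value of `a ^ 2 + D * b ^ 2`. -/
theorem sq_dvd_of_dvd_sq_add {p : ℕ} (hp : p.Prime) (h4 : p % 4 = 3) {D : ℤ}
    (hD : ∃ t : ZMod p, t ≠ 0 ∧ t ^ 2 = (D : ZMod p)) {a b : ℤ}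
    (h : (p : ℤ) ∣ a ^ 2 + D * b ^ 2) : (p : ℤ) ^ 2 ∣ a ^ 2 + D * b ^ 2 := by
  have := Fact.mk hp
  obtain ⟨t, ht0, ht⟩ := hD
  have h1 : (a : ZMod p) ^ 2 + (t * b) ^ 2 = 0 := by
    rw [mul_pow, ht]
    exact_mod_cast (ZMod.intCast_zmod_eq_zero_iff_dvd _ p).2 h
  have h2 : (b : ZMod p) = 0 := by
    by_contra hb
    have hne : t * (b : ZMod p) ≠ 0 := mul_ne_zero ht0 hb
    have : IsSquare (-1 : ZMod p) := ⟨a / (t * b), by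
      field_simp
      linear_combination -h1⟩
    exact (ZMod.exists_sq_eq_neg_one_iff.1 this) h4
  have h3 : (a : ZMod p) = 0 := by
    rw [h2] at h1
    simpa using h1
  have ha := (ZMod.intCast_zmod_eq_zero_iff_dvd _ p).1 h3
  have hb := (ZMod.intCast_zmod_eq_zero_iff_dvd _ p).1 h2
  exact dvd_add (pow_dvd_pow_of_dvd ha 2) (dvd_mul_of_dvd_right (pow_dvd_pow_of_dvd hb 2) D)

theorem sq_dvd_of_dvd_add_sq {p : ℕ} (hp : p.Prime) (h4 : p % 4 = 3) {a b : ℤ}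
    (h : (p : ℤ) ∣ a ^ 2 + b ^ 2) : (p : ℤ) ^ 2 ∣ a ^ 2 + b ^ 2 := by
  have := Fact.mk hp
  have := sq_dvd_of_dvd_sq_add (D := 1) (a := a) (b := b) hp h4 ⟨1, one_ne_zero, by simp⟩
    (by simpa using h)
  simpa using this

theorem sq_dvd_of_dvd_add_five_sq {p : ℕ} (hp : p.Prime) (h20 : p % 20 = 11 ∨ p % 20 = 19)
    {a b : ℤ} (h : (p : ℤ) ∣ a ^ 2 + 5 * b ^ 2) : (p : ℤ) ^ 2 ∣ a ^ 2 + 5 * b ^ 2 := by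
  have := Fact.mk hp
  have : Fact (Nat.Prime 5) := ⟨by norm_num⟩
  refine sq_dvd_of_dvd_sq_add hp (by omega) ?_ h
  have h1 : IsSquare (p : ZMod 5) := by
    rw [← ZMod.natCast_mod]
    rcases (by omega : p % 5 = 1 ∨ p % 5 = 4) with h | h <;> rw [h]
    · exact ⟨1, by norm_num⟩
    · exact ⟨2, by norm_num⟩
  have h2 : IsSquare ((5 : ℕ) : ZMod p) :=
    (ZMod.exists_sq_eq_prime_iff_of_mod_four_eq_one (p := 5) (q := p) (by norm_num)
      (by omega)).1 h1
  obtain ⟨t, ht⟩ := h2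
  have h5 : ((5 : ℕ) : ZMod p) ≠ 0 := fun h0 => by
    rw [ZMod.natCast_eq_zero_iff] at h0
    have := (Nat.prime_dvd_prime_iff_eq hp (by norm_num)).1 h0
    omega
  refine ⟨t, fun h0 => h5 (by rw [ht, h0, zero_mul]), ?_⟩
  rw [sq, ← ht]
  norm_num

theorem coeff_six_ne_zero {n : ℕ} (h : PowerSeries.coeff n (eulerMod 1 ^ 6) ≠ 0) :
    ∃ c : ℤ, 4 * (n : ℤ) + 1 = c ^ 2 := by
  rw [show eulerMod 1 ^ 6 = (eulerMod 1 ^ 3) ^ 2 by ring, eulerMod_one_pow_three, oddSquares,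
    qSum_sq finFib_sqExp_four] at h
  obtain ⟨c, hc, hn⟩ := exists_of_coeff_qSum_ne_zero h
  simp only [Set.mem_ofPred_eq] at hc
  have := sqExp_spec (c := c) (by omega)
  exact ⟨c, by rw [← this, ← hn]; push_cast; ring⟩

theorem coeff_X_mul_six_ne_zero {n : ℕ}
    (h : PowerSeries.coeff n (PowerSeries.X * eulerMod 5 ^ 6) ≠ 0) :
    ∃ c : ℤ, 4 * (n : ℤ) + 1 = 5 * c ^ 2 := by
  rw [X_mul_eulerMod_five_pow_six] at h
  obtain ⟨c, hc, hn⟩ := exists_of_coeff_qSum_ne_zero h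
  simp only [Set.mem_ofPred_eq] at hc
  have := sqExp_spec (c := c) (by omega)
  exact ⟨c, by rw [← this, ← hn]; push_cast; ring⟩

theorem coeff_three_ne_zero {n : ℕ} (h : PowerSeries.coeff n (eulerMod 1 ^ 3) ≠ 0) :
    ∃ c : ℤ, 8 * (n : ℤ) + 1 = c ^ 2 := by
  rw [eulerMod_one_pow_three] at h
  obtain ⟨c, hc, hn⟩ := exists_of_coeff_qSum_ne_zero h
  simp only [Set.mem_ofPred_eq] at hc
  exact ⟨c, by rw [← sqExp_spec (c := c) (by omega), ← hn]⟩

theorem coeff_X_mul_three_ne_zero {n : ℕ}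
    (h : PowerSeries.coeff n ((PowerSeries.X * eulerMod 25) ^ 3) ≠ 0) :
    ∃ c : ℤ, 8 * (n : ℤ) + 1 = c ^ 2 := by
  rw [X_mul_eulerMod_pow_three] at h
  obtain ⟨c, hc, hn⟩ := exists_of_coeff_qSum_ne_zero h
  simp only [Set.mem_ofPred_eq] at hc
  exact ⟨c, by rw [← sqExp_spec (c := c) (by omega), ← hn]⟩

theorem coeff_X_mul_twentyfive_six_ne_zero {n : ℕ}
    (h : PowerSeries.coeff n ((PowerSeries.X * eulerMod 25) ^ 6) ≠ 0) :
    ∃ c : ℤ, 4 * (n : ℤ) + 1 = c ^ 2 := by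
  have f5 : FinFib {c : ℤ | c % 20 = 5} sqExp :=
    finFib_sqExp fun c hc => by simp only [Set.mem_ofPred_eq] at hc; omega
  rw [show (PowerSeries.X * eulerMod 25) ^ 6 = ((PowerSeries.X * eulerMod 25) ^ 3) ^ 2 by ring,
    X_mul_eulerMod_pow_three, oddSquares, qSum_sq f5] at h
  obtain ⟨c, hc, hn⟩ := exists_of_coeff_qSum_ne_zero h
  simp only [Set.mem_ofPred_eq] at hc
  have := sqExp_spec (c := c) (by omega)
  exact ⟨c, by rw [← this, ← hn]; push_cast; ring⟩

/-- If `p` divides `4 * n + 1` exactly, the factorizations `4 * n + 1 = d * e` cancel in pairs: `p`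
moves from one factor to the other, both change sign, and for `p ≡ 11` modulo 20 they are also
exchanged. This preserves the residues of `d` and `e` modulo 20. -/
theorem coeff_lambert_eq_zero {a b r : ℤ} (h : GoodResidues a b r) {p : ℕ} (hp : p.Prime)
    (h20 : p % 20 = 11 ∨ p % 20 = 19) {n : ℕ} (h1 : (p : ℤ) ∣ 4 * n + 1)
    (h2 : ¬ (p : ℤ) ^ 2 ∣ 4 * n + 1) : PowerSeries.coeff n (lambert a b) = 0 := by
  have hpi : Prime (p : ℤ) := Nat.prime_iff_prime_int.1 hp
  have hp0 : (p : ℤ) ≠ 0 := hpi.ne_zero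
  have hpos : (0 : ℤ) < p := by exact_mod_cast hp.pos
  rw [lambert, coeff_qSum, ZMod.natCast_eq_zero_iff_even]
  have hset : {i | i ∈ lambertPairs a b ∧ lambertExp i = n} =
      {i : ℤ × ℤ | i.1 % 20 = a ∧ i.2 % 20 = b ∧ i.1 * i.2 = 4 * n + 1} := by
    ext ⟨d, e⟩
    constructor
    · rintro ⟨hi, hn⟩
      have := lambertExp_spec' h hi
      rw [hn] at this
      exact ⟨hi.1, hi.2.1, this.symm⟩
    · rintro ⟨h3, h4, h5⟩
      dsimp only at h3 h4 h5
      have hi : (d, e) ∈ lambertPairs a b := ⟨h3, h4, by dsimp only; rw [h5]; positivity⟩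
      have := lambertExp_spec' h hi
      dsimp only at this
      exact ⟨hi, by omega⟩
  rw [hset]
  have cases : ∀ d e : ℤ, d * e = 4 * n + 1 →
      (∃ x, d = p * x ∧ ¬ (p : ℤ) ∣ x ∧ ¬ (p : ℤ) ∣ e) ∨
      (∃ y, e = p * y ∧ ¬ (p : ℤ) ∣ y ∧ ¬ (p : ℤ) ∣ d) := by
    intro d e hde
    rw [← hde] at h1 h2
    rcases hpi.dvd_or_dvd h1 with ⟨x, hx⟩ | ⟨y, hy⟩
    · refine Or.inl ⟨x, hx, fun ⟨z, hz⟩ => h2 ⟨z * e, ?_⟩, fun ⟨z, hz⟩ => h2 ⟨x * z, ?_⟩⟩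
      · rw [hx, hz]; ring
      · rw [hx, hz]; ring
    · refine Or.inr ⟨y, hy, fun ⟨z, hz⟩ => h2 ⟨d * z, ?_⟩, fun ⟨z, hz⟩ => h2 ⟨z * y, ?_⟩⟩
      · rw [hy, hz]; ring
      · rw [hy, hz]; ring
  have hmod : ∀ x : ℤ, ((p : ℤ) * x) % 20 = ((p : ℤ) % 20 * (x % 20)) % 20 :=
    fun x => Int.mul_emod _ _ _
  rcases h20 with h20 | h20
  · have hP : (p : ℤ) % 20 = 11 := by omega
    refine ncard_even_of_involution
      (fun i => if (p : ℤ) ∣ i.1 then (-(p * i.2), -(i.1 / p)) else (-(i.2 / p), -(p * i.1)))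
      ?_ ?_ ?_
    · rintro ⟨d, e⟩ ⟨h3, h4, h5⟩
      dsimp only at h3 h4 h5 ⊢
      rcases cases d e h5 with ⟨x, rfl, hx, he⟩ | ⟨y, rfl, hy, hd⟩
      · rw [if_pos (dvd_mul_right _ _), Int.mul_ediv_cancel_left _ hp0]
        have e1 := hmod x
        have e2 := hmod e
        rw [hP] at e1 e2
        refine ⟨?_, ?_, ?_⟩
        · dsimp only
          rcases h with ⟨h, h', -⟩ | ⟨h, h', -⟩ <;> omega
        · dsimp only
          rcases h with ⟨h, h', -⟩ | ⟨h, h', -⟩ <;> omega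
        · dsimp only; linear_combination h5
      · rw [if_neg hd, Int.mul_ediv_cancel_left _ hp0]
        have e1 := hmod y
        have e2 := hmod d
        rw [hP] at e1 e2
        refine ⟨?_, ?_, ?_⟩
        · dsimp only
          rcases h with ⟨h, h', -⟩ | ⟨h, h', -⟩ <;> omega
        · dsimp only
          rcases h with ⟨h, h', -⟩ | ⟨h, h', -⟩ <;> omega
        · dsimp only; linear_combination h5
    · rintro ⟨d, e⟩ ⟨h3, h4, h5⟩
      dsimp only at h3 h4 h5 ⊢
      rcases cases d e h5 with ⟨x, rfl, hx, he⟩ | ⟨y, rfl, hy, hd⟩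
      · rw [if_pos (dvd_mul_right _ _), Int.mul_ediv_cancel_left _ hp0]
        dsimp only
        rw [if_pos (by rw [dvd_neg]; exact dvd_mul_right _ _),
          show -((p : ℤ) * e) = p * (-e) by ring, Int.mul_ediv_cancel_left _ hp0]
        ext <;> dsimp only <;> ring
      · rw [if_neg hd, Int.mul_ediv_cancel_left _ hp0]
        dsimp only
        rw [if_neg (by rwa [dvd_neg]), show -((p : ℤ) * d) = p * (-d) by ring,
          Int.mul_ediv_cancel_left _ hp0]
        ext <;> dsimp only <;> ring
    · rintro ⟨d, e⟩ ⟨h3, h4, h5⟩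
      dsimp only at h3 h4 h5 ⊢
      have hpos2 : (0 : ℤ) < 4 * n + 1 := by positivity
      rcases cases d e h5 with ⟨x, rfl, hx, he⟩ | ⟨y, rfl, hy, hd⟩
      · rw [if_pos (dvd_mul_right _ _)]
        intro heq
        simp only [Prod.mk.injEq] at heq
        have : (p : ℤ) * x * e = -(p * e ^ 2) := by rw [← heq.1]; ring
        rw [this] at h5
        nlinarith [mul_nonneg hpos.le (sq_nonneg e)]
      · rw [if_neg hd]
        intro heq
        simp only [Prod.mk.injEq] at heq
        have : d * ((p : ℤ) * y) = -(p * d ^ 2) := by rw [← heq.2]; ring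
        rw [this] at h5
        nlinarith [mul_nonneg hpos.le (sq_nonneg d)]
  · have hP : (p : ℤ) % 20 = 19 := by omega
    refine ncard_even_of_involution
      (fun i => if (p : ℤ) ∣ i.1 then (-(i.1 / p), -(p * i.2)) else (-(p * i.1), -(i.2 / p)))
      ?_ ?_ ?_
    · rintro ⟨d, e⟩ ⟨h3, h4, h5⟩
      dsimp only at h3 h4 h5 ⊢
      rcases cases d e h5 with ⟨x, rfl, hx, he⟩ | ⟨y, rfl, hy, hd⟩
      · rw [if_pos (dvd_mul_right _ _), Int.mul_ediv_cancel_left _ hp0]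
        have e1 := hmod x
        have e2 := hmod e
        rw [hP] at e1 e2
        refine ⟨?_, ?_, ?_⟩
        · dsimp only
          rcases h with ⟨h, h', -⟩ | ⟨h, h', -⟩ <;> omega
        · dsimp only
          rcases h with ⟨h, h', -⟩ | ⟨h, h', -⟩ <;> omega
        · dsimp only; linear_combination h5
      · rw [if_neg hd, Int.mul_ediv_cancel_left _ hp0]
        have e1 := hmod y
        have e2 := hmod d
        rw [hP] at e1 e2
        refine ⟨?_, ?_, ?_⟩
        · dsimp only
          rcases h with ⟨h, h', -⟩ | ⟨h, h', -⟩ <;> omega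
        · dsimp only
          rcases h with ⟨h, h', -⟩ | ⟨h, h', -⟩ <;> omega
        · dsimp only; linear_combination h5
    · rintro ⟨d, e⟩ ⟨h3, h4, h5⟩
      dsimp only at h3 h4 h5 ⊢
      rcases cases d e h5 with ⟨x, rfl, hx, he⟩ | ⟨y, rfl, hy, hd⟩
      · rw [if_pos (dvd_mul_right _ _), Int.mul_ediv_cancel_left _ hp0]
        dsimp only
        rw [if_neg (by rwa [dvd_neg]), show -((p : ℤ) * e) = p * (-e) by ring,
          Int.mul_ediv_cancel_left _ hp0]
        ext <;> dsimp only <;> ring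
      · rw [if_neg hd, Int.mul_ediv_cancel_left _ hp0]
        dsimp only
        rw [if_pos (by rw [dvd_neg]; exact dvd_mul_right _ _),
          show -((p : ℤ) * d) = p * (-d) by ring, Int.mul_ediv_cancel_left _ hp0]
        ext <;> dsimp only <;> ring
    · rintro ⟨d, e⟩ ⟨h3, h4, h5⟩
      dsimp only at h3 h4 h5 ⊢
      rcases cases d e h5 with ⟨x, rfl, hx, he⟩ | ⟨y, rfl, hy, hd⟩
      · rw [if_pos (dvd_mul_right _ _)]
        intro heq
        simp only [Prod.mk.injEq] at heq
        exact he ⟨-e, by linear_combination -heq.2⟩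
      · rw [if_neg hd]
        intro heq
        simp only [Prod.mk.injEq] at heq
        exact hd ⟨-d, by linear_combination -heq.1⟩

/-- No term in the expansion `regularMod_four_mul` contributes to a coefficient for which `p` divides
`4 * n + 1` exactly: this number is neither a square nor 5 times a square, twice it is not a sum
of two squares, and the factorizations in the Lambert series cancel. -/
theorem even_regularB_four_mul {p : ℕ} (hp : p.Prime) (h20 : p % 20 = 11 ∨ p % 20 = 19) {n : ℕ}
    (h1 : (p : ℤ) ∣ 4 * n + 1) (h2 : ¬ (p : ℤ) ^ 2 ∣ 4 * n + 1) :
    Even (regularB 25 (4 * n)) := by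
  have hpi : Prime (p : ℤ) := Nat.prime_iff_prime_int.1 hp
  have hsq : ∀ c : ℤ, (4 * n + 1 : ℤ) ≠ c ^ 2 := fun c hc => by
    rw [hc] at h1 h2
    exact h2 (pow_dvd_pow_of_dvd (hpi.dvd_of_dvd_pow h1) 2)
  rw [even_regularB_iff, show 4 * n = 2 * (2 * n + 0) + 0 by ring, ← coeff_section2,
    ← coeff_section2, regularMod_four_mul]
  simp only [map_add]
  rw [coeff_lambert_eq_zero (r := 1) (by simp [GoodResidues]) hp h20 h1 h2,
    coeff_lambert_eq_zero (r := 2) (by simp [GoodResidues]) hp h20 h1 h2]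
  have z1 : PowerSeries.coeff n (eulerMod 1 ^ 6) = 0 := by
    by_contra hne
    obtain ⟨c, hc⟩ := coeff_six_ne_zero hne
    exact hsq c hc
  have z2 : PowerSeries.coeff n (PowerSeries.X * eulerMod 5 ^ 6) = 0 := by
    by_contra hne
    obtain ⟨c, hc⟩ := coeff_X_mul_six_ne_zero hne
    have := sq_dvd_of_dvd_add_five_sq (a := 0) (b := c) hp h20 (by rw [hc] at h1; simpa using h1)
    exact h2 (by rw [hc]; simpa using this)
  have z3 : PowerSeries.coeff n ((PowerSeries.X * eulerMod 25) ^ 6) = 0 := by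
    by_contra hne
    obtain ⟨c, hc⟩ := coeff_X_mul_twentyfive_six_ne_zero hne
    exact hsq c hc
  have z4 : PowerSeries.coeff n (eulerMod 1 ^ 3 * (PowerSeries.X * eulerMod 25) ^ 3) = 0 := by
    by_contra hne
    obtain ⟨i, j, hij, hi, hj⟩ := exists_of_coeff_mul_ne_zero hne
    obtain ⟨c, hc⟩ := coeff_three_ne_zero hi
    obtain ⟨d, hd⟩ := coeff_X_mul_three_ne_zero hj
    have hcd : c ^ 2 + d ^ 2 = 2 * (4 * n + 1) := by rw [← hc, ← hd, ← hij]; push_cast; ring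
    have := sq_dvd_of_dvd_add_sq (a := c) (b := d) hp (by omega)
      (by rw [hcd]; exact dvd_mul_of_dvd_right h1 2)
    rw [hcd] at this
    refine h2 (IsCoprime.dvd_of_dvd_mul_left ?_ this)
    refine IsCoprime.pow_left ?_
    exact_mod_cast (Nat.isCoprime_iff_coprime.2
      ((Nat.coprime_primes hp Nat.prime_two).2 (by omega)))
  rw [z1, z2, z3, z4]
  simp

/-- The product in `regularMod_four_mul_add_one` writes `2 * (2 * n + 1)` as a sum of two squares or
as a square plus 5 times a square, which is impossible if `p` divides `2 * n + 1` exactly. -/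
theorem even_regularB_four_mul_add_one {p : ℕ} (hp : p.Prime) (h20 : p % 20 = 11 ∨ p % 20 = 19)
    {n : ℕ} (h1 : (p : ℤ) ∣ 2 * n + 1) (h2 : ¬ (p : ℤ) ^ 2 ∣ 2 * n + 1) :
    Even (regularB 25 (4 * n + 1)) := by
  rw [even_regularB_iff, show 4 * n + 1 = 2 * (2 * n + 0) + 1 by ring, ← coeff_section2,
    ← coeff_section2, regularMod_four_mul_add_one]
  by_contra hne
  obtain ⟨i, j, hij, hi, hj⟩ := exists_of_coeff_mul_ne_zero hne
  have hc : ∃ c : ℤ, 4 * (i : ℤ) + 1 = c ^ 2 := by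
    rw [map_add] at hi
    by_cases h0 : PowerSeries.coeff i (eulerMod 1 ^ 6) = 0
    · exact coeff_X_mul_twentyfive_six_ne_zero (by simpa [h0] using hi)
    · exact coeff_six_ne_zero h0
  have hd : ∃ d : ℤ, 4 * (j : ℤ) + 1 = d ^ 2 ∨ 4 * (j : ℤ) + 1 = 5 * d ^ 2 := by
    rw [map_add] at hj
    by_cases h0 : PowerSeries.coeff j (eulerMod 1 ^ 6) = 0
    · obtain ⟨d, hd⟩ := coeff_X_mul_six_ne_zero (by simpa only [h0, zero_add] using hj)
      exact ⟨d, Or.inr hd⟩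
    · obtain ⟨d, hd⟩ := coeff_six_ne_zero h0
      exact ⟨d, Or.inl hd⟩
  have hcop : IsCoprime ((p : ℤ) ^ 2) 2 := by
    refine IsCoprime.pow_left ?_
    exact_mod_cast (Nat.isCoprime_iff_coprime.2
      ((Nat.coprime_primes hp Nat.prime_two).2 (by omega)))
  obtain ⟨c, hc⟩ := hc
  obtain ⟨d, hd | hd⟩ := hd
  · have hcd : c ^ 2 + d ^ 2 = 2 * (2 * n + 1) := by rw [← hc, ← hd, ← hij]; push_cast; ring
    have := sq_dvd_of_dvd_add_sq (a := c) (b := d) hp (by omega)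
      (by rw [hcd]; exact dvd_mul_of_dvd_right h1 2)
    rw [hcd] at this
    exact h2 (hcop.dvd_of_dvd_mul_left this)
  · have hcd : c ^ 2 + 5 * d ^ 2 = 2 * (2 * n + 1) := by rw [← hc, ← hd, ← hij]; push_cast; ring
    have := sq_dvd_of_dvd_add_five_sq (a := c) (b := d) hp h20
      (by rw [hcd]; exact dvd_mul_of_dvd_right h1 2)
    rw [hcd] at this
    exact h2 (hcop.dvd_of_dvd_mul_left this)

theorem inClass_eulerMod_five : InClass 0 (eulerMod 5) := by
  intro n hn
  rw [eulerMod_eq_expand 5 (by norm_num), PowerSeries.coeff_expand] at hn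
  have : 5 ∣ n := by
    by_contra h
    simp [h] at hn
  omega

/-- By the 5-dissection of `f_1`, the series in `regularMod_eight_mul_add_two` has no exponent
congruent to 4 modulo 5. -/
theorem even_regularB_forty (n : ℕ) : Even (regularB 25 (40 * n + 34)) := by
  rw [even_regularB_iff, show 40 * n + 34 = 2 * (2 * (2 * (5 * n + 4) + 0) + 1) + 0 by ring,
    ← coeff_section2, ← coeff_section2, ← coeff_section2, regularMod_eight_mul_add_two]
  have ha := inClass_eulerPartZero
  have hb := inClass_eulerPartTwo
  have hk := inClass_X_mul_eulerMod
  have hg := inClass_eulerMod_five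
  rw [eulerMod_one_dissection]
  generalize eulerPartZero = a at *
  generalize eulerPartTwo = b at *
  generalize PowerSeries.X * eulerMod 25 = k at *
  generalize eulerMod 5 = g at *
  have e : g * k ^ 2 * ((a + k + b) ^ 2 + (a + k + b) * k) =
      g * k ^ 2 * a ^ 2 + g * k ^ 2 * b ^ 2 + g * k ^ 2 * (a * k) + g * k ^ 2 * (b * k) := by
    linear_combination g * k ^ 2 * (k ^ 2 + a * k + a * b + b * k) * two_eq_zero_series
  have hgk := hg.mul (hk.pow 2)
  have van : ∀ (r : ℕ) (f : PowerSeries (ZMod 2)), InClass r f → r % 5 ≠ 4 →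
      PowerSeries.coeff (5 * n + 4) f = 0 := fun r f hf hr => by
    by_contra hne
    have := hf _ hne
    omega
  rw [e, map_add, map_add, map_add, van _ _ (hgk.mul (ha.pow 2)) (by decide),
    van _ _ (hgk.mul (hb.pow 2)) (by decide), van _ _ (hgk.mul (ha.mul hk)) (by decide),
    van _ _ (hgk.mul (hb.mul hk)) (by decide)]
  simp

theorem coeff_regularMod_eight (n : ℕ) : PowerSeries.coeff (8 * n + 3) regularMod =
    PowerSeries.coeff n (eulerMod 1 ^ 12 + (PowerSeries.X * eulerMod 25) ^ 12) := by
  rw [show 8 * n + 3 = 2 * (2 * (2 * n + 0) + 1) + 1 by ring, ← coeff_section2, ← coeff_section2,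
    ← coeff_section2, regularMod_eight_mul_add_three]

theorem seriesModEqTwo_eight : SeriesModEqTwo (PowerSeries.mk fun n => regularB 25 (8 * n + 3))
      (eulerF 1 ^ 12 + PowerSeries.X ^ 12 * eulerF 25 ^ 12) := by
  intro n
  have h : ((PowerSeries.coeff n (eulerF 1 ^ 12 + PowerSeries.X ^ 12 * eulerF 25 ^ 12) : ℤ) :
      ZMod 2) =
      PowerSeries.coeff n (eulerMod 1 ^ 12 + (PowerSeries.X * eulerMod 25) ^ 12) := by
    rw [eulerMod, eulerMod, mul_pow, ← map_pow, ← map_pow,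
      ← PowerSeries.map_X (Int.castRingHom (ZMod 2)), ← map_pow, ← map_mul, ← map_add,
      PowerSeries.coeff_map]
    rfl
  rw [← coeff_regularMod_eight, coeff_regularMod] at h
  rw [PowerSeries.coeff_mk]
  exact (ZMod.intCast_eq_intCast_iff _ _ 2).1 h.symm

theorem choose_two_mul_two (t : ℕ) : (t + 1).choose 2 * 2 = (t + 1) * t := by
  rw [Nat.choose_two_right, Nat.add_sub_cancel]
  exact Nat.div_mul_cancel (by rw [mul_comm]; exact (Nat.even_mul_succ_self t).two_dvd)

theorem exists_sqExp_eq_choose {c : ℤ} (hc : c % 2 = 1) : ∃ t : ℕ, sqExp c = (t + 1).choose 2 := by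
  obtain ⟨t, ht⟩ : ∃ t : ℕ, c ^ 2 = (2 * (t : ℤ) + 1) ^ 2 := by
    refine ⟨((|c| - 1) / 2).toNat, ?_⟩
    rw [← sq_abs c]
    congr 1
    rcases abs_cases c with ⟨h, _⟩ | ⟨h, _⟩ <;> rw [h] <;> omega
  refine ⟨t, ?_⟩
  have h1 := sqExp_spec hc
  have h2 := choose_two_mul_two t
  zify at h2 ⊢
  linarith

theorem qSum_pow_four {s : Set ℤ} {e : ℤ → ℕ} (hs : FinFib s e) :
    qSum s e ^ 4 = qSum s (fun c => 4 * e c) := by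
  rw [show qSum s e ^ 4 = (qSum s e ^ 2) ^ 2 by ring, qSum_sq hs,
    qSum_sq (e := fun c => 2 * e c) (hs.mul_add 2 two_ne_zero 0)]
  congr 1
  ext c
  ring

theorem odd_regularB_eight {n : ℕ} (h : ¬ Even (regularB 25 (8 * n + 3))) :
    (∃ t : ℕ, n = 4 * (t + 1).choose 2) ∨ (∃ t : ℕ, n = 12 + 100 * (t + 1).choose 2) := by
  rw [even_regularB_iff, coeff_regularMod_eight, map_add] at h
  by_cases h0 : PowerSeries.coeff n (eulerMod 1 ^ 12) = 0
  · right
    rw [h0, zero_add, mul_pow, show eulerMod 25 ^ 12 = (eulerMod 25 ^ 3) ^ 4 by ring,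
      eulerMod_mul_pow_three 25 (by norm_num),
      qSum_pow_four (e := fun c => 25 * sqExp c)
        (finFib_sqExp_four.mul_add 25 (by norm_num) 0), qSum_X_pow_mul] at h
    obtain ⟨c, hc, hn⟩ := exists_of_coeff_qSum_ne_zero h
    simp only [Set.mem_ofPred_eq] at hc
    obtain ⟨t, ht⟩ := exists_sqExp_eq_choose (c := c) (by omega)
    exact ⟨t, by omega⟩
  · left
    rw [show eulerMod 1 ^ 12 = (eulerMod 1 ^ 3) ^ 4 by ring, eulerMod_one_pow_three, oddSquares,
      qSum_pow_four finFib_sqExp_four] at h0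
    obtain ⟨c, hc, hn⟩ := exists_of_coeff_qSum_ne_zero h0
    simp only [Set.mem_ofPred_eq] at hc
    obtain ⟨t, ht⟩ := exists_sqExp_eq_choose (c := c) (by omega)
    exact ⟨t, by omega⟩

theorem exists_sq_of_odd_regularB_eight {n : ℕ} (h : ¬ Even (regularB 25 (8 * n + 3))) :
    ∃ c : ℕ, 2 * n + 1 = c ^ 2 := by
  rcases odd_regularB_eight h with ⟨t, ht⟩ | ⟨t, ht⟩
  · exact ⟨2 * t + 1, by have := choose_two_mul_two t; rw [ht]; nlinarith⟩
  · exact ⟨5 * (2 * t + 1), by have := choose_two_mul_two t; rw [ht]; nlinarith⟩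

theorem even_regularB_eight {p : ℕ} (hp : p.Prime) {n : ℕ}
    (h1 : p ∣ 2 * n + 1) (h2 : ¬ p ^ 2 ∣ 2 * n + 1) :
    Even (regularB 25 (8 * n + 3)) := by
  by_contra h
  obtain ⟨c, hc⟩ := exists_sq_of_odd_regularB_eight h
  rw [hc] at h1 h2
  exact h2 (pow_dvd_pow_of_dvd (hp.dvd_of_dvd_pow h1) 2)

/-! ### Reciprocals of primes in residue classes -/

open ArithmeticFunction in
/-- The sum of the reciprocals of the primes in an invertible residue class diverges. Otherwise
`g x = ∑ Λ(n) / (log n * n ^ x)`, over the `n` in the class, would be bounded for `x ≥ 1`, whereas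
the pole of `-g' x = ∑ Λ(n) / n ^ x` at `x = 1` makes `g` grow by a fixed amount, up to a summable
error, between `1 + 2 ^ (-k)` and `1 + 2 ^ (-k - 1)`. -/
theorem not_summable_inv_primes_residueClass {N : ℕ} [NeZero N] {a : ZMod N} (ha : IsUnit a) :
    ¬ Summable fun n : ℕ => if n.Prime ∧ (n : ZMod N) = a then (1 : ℝ) / n else 0 := by
  intro H
  set w : ℕ → ℝ := vonMangoldt.residueClass a with hw
  have w0 : ∀ n, 0 ≤ w n := vonMangoldt.residueClass_nonneg a
  have wz : ∀ n, n < 2 → w n = 0 := by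
    intro n hn
    refine le_antisymm ((vonMangoldt.residueClass_le a n).trans ?_) (w0 n)
    interval_cases n <;> simp
  obtain ⟨C, hC⟩ := vonMangoldt.LSeries_residueClass_lower_bound ha
  set c : ℝ := (N.totient : ℝ)⁻¹ with hc
  have hcpos : 0 < c := inv_pos.2 (by exact_mod_cast Nat.totient_pos.2 (NeZero.pos N))
  have hlog : ∀ n : ℕ, 2 ≤ n → Real.log 2 ≤ Real.log n := fun n hn =>
    Real.log_le_log (by norm_num) (by exact_mod_cast hn)
  have hlog2 : 0 < Real.log 2 := Real.log_pos (by norm_num)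
  -- the terms of `g`
  let t : ℝ → ℕ → ℝ := fun x n => w n / Real.log n / (n : ℝ) ^ x
  have t0 : ∀ x n, 0 ≤ t x n := fun x n =>
    div_nonneg (div_nonneg (w0 n) (Real.log_natCast_nonneg n)) (Real.rpow_nonneg n.cast_nonneg x)
  have s1 : Summable (t 1) := by
    have hs := H.add ((vonMangoldt.summable_residueClass_non_primes_div (a := a)).mul_left
      (Real.log 2)⁻¹)
    refine hs.of_nonneg_of_le (t0 1) fun n => ?_
    simp only [t, Real.rpow_one]
    rcases lt_or_ge n 2 with hn | hn
    · rw [wz n hn]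
      simp only [zero_div]
      refine add_nonneg (by split_ifs <;> positivity) ?_
      refine mul_nonneg (inv_nonneg.2 hlog2.le) (div_nonneg ?_ n.cast_nonneg)
      split_ifs
      · exact le_rfl
      · exact w0 n
    · have hn0 : (0 : ℝ) < n := by exact_mod_cast (by omega : 0 < n)
      have hl := hlog2.trans_le (hlog n hn)
      by_cases hp : n.Prime
      · by_cases hna : (n : ZMod N) = a
        · have : w n = Real.log n := by
            rw [hw, vonMangoldt.residueClass, Set.indicator_of_mem (by exact hna),
              vonMangoldt_apply_prime hp]
          rw [this, div_self hl.ne']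
          simp [hp, hna]
        · have : w n = 0 := by
            rw [hw, vonMangoldt.residueClass, Set.indicator_of_notMem (by exact hna)]
          rw [this]
          simp [hp, hna]
      · simp only [hp, false_and, if_false, zero_add]
        rw [inv_mul_eq_div, div_div, div_div, mul_comm (n : ℝ)]
        refine div_le_div_of_nonneg_left (w0 n) (by positivity) ?_
        exact mul_le_mul_of_nonneg_right (hlog n hn) hn0.le
  have tle : ∀ x, 1 ≤ x → ∀ n, t x n ≤ t 1 n := by
    intro x hx n
    rcases lt_or_ge n 2 with hn | hn
    · simp [t, wz n hn]
    · refine div_le_div_of_nonneg_left (div_nonneg (w0 n) (Real.log_natCast_nonneg n)) ?_ ?_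
      · exact Real.rpow_pos_of_pos (by exact_mod_cast (by omega : 0 < n)) _
      · exact Real.rpow_le_rpow_of_exponent_le (by exact_mod_cast (by omega : 1 ≤ n)) hx
  have s : ∀ x, 1 ≤ x → Summable (t x) := fun x hx => s1.of_nonneg_of_le (t0 x) (tle x hx)
  have hdiff : ∀ x y, 1 ≤ x → x ≤ y → ∀ n, (y - x) * (w n / (n : ℝ) ^ y) ≤ t x n - t y n := by
    intro x y hx hxy n
    rcases lt_or_ge n 2 with hn | hn
    · simp [t, wz n hn]
    · have hn0 : (0 : ℝ) < n := by exact_mod_cast (by omega : 0 < n)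
      have hl := hlog2.trans_le (hlog n hn)
      have h1 : (n : ℝ) ^ y = (n : ℝ) ^ x * (n : ℝ) ^ (y - x) := by
        rw [← Real.rpow_add hn0]; ring_nf
      have h2 : 1 + (y - x) * Real.log n ≤ (n : ℝ) ^ (y - x) := by
        rw [Real.rpow_def_of_pos hn0]
        have := Real.add_one_le_exp (Real.log n * (y - x))
        linarith
      have hX := Real.rpow_pos_of_pos hn0 x
      have hY := Real.rpow_pos_of_pos hn0 (y - x)
      have e : t x n - t y n - (y - x) * (w n / (n : ℝ) ^ y) =
          w n / Real.log n / (n : ℝ) ^ y * ((n : ℝ) ^ (y - x) - (1 + (y - x) * Real.log n)) := by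
        simp only [t]
        rw [h1]
        field_simp
        ring
      have : 0 ≤ w n / Real.log n / (n : ℝ) ^ y *
          ((n : ℝ) ^ (y - x) - (1 + (y - x) * Real.log n)) :=
        mul_nonneg (t0 y n) (sub_nonneg.2 h2)
      linarith
  have step : ∀ x y, 1 ≤ x → x < y → y ≤ 2 →
      (y - x) * (c / (y - 1) - C) ≤ ∑' n, t x n - ∑' n, t y n := by
    intro x y hx hxy hy
    have hsum : Summable fun n => (y - x) * (w n / (n : ℝ) ^ y) :=
      ((s x hx).sub (s y (by linarith))).of_nonneg_of_le
        (fun n => mul_nonneg (by linarith) (div_nonneg (w0 n) (Real.rpow_nonneg n.cast_nonneg y)))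
        (hdiff x y hx hxy.le)
    rw [← (s x hx).tsum_sub (s y (by linarith))]
    refine le_trans ?_ (hsum.tsum_le_tsum (hdiff x y hx hxy.le) ((s x hx).sub (s y (by linarith))))
    rw [tsum_mul_left]
    exact mul_le_mul_of_nonneg_left (hC ⟨by linarith, hy⟩) (by linarith)
  -- summation of the increments
  have tele : ∀ k : ℕ, k * (c / 2) - |C| * (1 - (1 / 2) ^ k) ≤
      ∑' n, t (1 + (1 / 2) ^ k) n - ∑' n, t 2 n := by
    intro k
    induction k with
    | zero => norm_num
    | succ k ih =>
      have hk : (0 : ℝ) < (1 / 2) ^ k := by positivity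
      have hk1 : ((1 : ℝ) / 2) ^ k ≤ 1 := pow_le_one₀ (by norm_num) (by norm_num)
      have h := step (1 + (1 / 2) ^ (k + 1)) (1 + (1 / 2) ^ k) (by
        have : (0 : ℝ) < (1 / 2) ^ (k + 1) := by positivity
        linarith) (by rw [pow_succ]; linarith) (by linarith)
      have e : (1 + (1 / 2 : ℝ) ^ k - (1 + (1 / 2) ^ (k + 1))) *
          (c / (1 + (1 / 2) ^ k - 1) - C) = c / 2 - C * ((1 / 2) ^ k / 2) := by
        rw [pow_succ]
        field_simp
        ring
      rw [e] at h
      have hCa : C * ((1 / 2 : ℝ) ^ k / 2) ≤ |C| * ((1 / 2) ^ k / 2) :=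
        mul_le_mul_of_nonneg_right (le_abs_self C) (by positivity)
      push_cast
      rw [pow_succ] at h ⊢
      nlinarith
  obtain ⟨k, hk⟩ := exists_nat_gt ((∑' n, t 1 n + |C|) / (c / 2))
  rw [div_lt_iff₀ (by positivity)] at hk
  have h1 := tele k
  have h2 : ∑' n, t (1 + (1 / 2) ^ k) n ≤ ∑' n, t 1 n := by
    have hk0 : (0 : ℝ) < (1 / 2) ^ k := by positivity
    exact (s _ (by linarith)).tsum_le_tsum (tle _ (by linarith)) s1
  have h3 : 0 ≤ ∑' n, t 2 n := tsum_nonneg (t0 2)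
  have h4 : |C| * (1 - (1 / 2 : ℝ) ^ k) ≤ |C| := by
    have hk0 : (0 : ℝ) < (1 / 2) ^ k := by positivity
    nlinarith [abs_nonneg C]
  linarith

/-- There are finite sets of primes `p ≡ 31` modulo 40 with arbitrarily large sum of reciprocals. -/
theorem exists_primes_sum_inv_gt (K : ℝ) :
    ∃ S : Finset ℕ, (∀ p ∈ S, p.Prime ∧ p % 40 = 31) ∧ K < ∑ p ∈ S, (1 : ℝ) / p := by
  have ha : IsUnit ((31 : ℕ) : ZMod 40) := (ZMod.isUnit_iff_coprime 31 40).2 (by norm_num)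
  have h := not_summable_inv_primes_residueClass ha
  rw [not_summable_iff_tendsto_nat_atTop_of_nonneg (fun n => by split_ifs <;> positivity)] at h
  obtain ⟨m, hm⟩ := (h.eventually_gt_atTop K).exists
  refine ⟨(Finset.range m).filter fun n => n.Prime ∧ (n : ZMod 40) = ((31 : ℕ) : ZMod 40), ?_, ?_⟩
  · intro p hp
    obtain ⟨-, hp1, hp2⟩ := Finset.mem_filter.1 hp
    exact ⟨hp1, (ZMod.natCast_eq_natCast_iff p 31 40).1 hp2⟩
  · rwa [Finset.sum_filter]

/-! ### A sieve by exact divisibility -/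

/-- No prime in `S` divides `c * n + 1` exactly once. -/
def AvoidsExact (c : ℕ) (S : Finset ℕ) (n : ℕ) : Prop :=
  ∀ p ∈ S, p ∣ c * n + 1 → p ^ 2 ∣ c * n + 1

theorem avoidsExact_mod {c : ℕ} {S : Finset ℕ} {n Q : ℕ} (hQ : ∀ p ∈ S, p ^ 2 ∣ Q) :
    AvoidsExact c S (n % Q) ↔ AvoidsExact c S n := by
  refine forall₂_congr fun p hp => ?_
  have h2 : c * (n % Q) + 1 ≡ c * n + 1 [MOD p ^ 2] :=
    (((Nat.mod_modEq n Q).of_dvd (hQ p hp)).mul_left c).add_right 1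
  have h1 : c * (n % Q) + 1 ≡ c * n + 1 [MOD p] := h2.of_dvd (dvd_pow_self p two_ne_zero)
  rw [h1.dvd_iff dvd_rfl, h2.dvd_iff dvd_rfl]

open Classical in
/-- Among the residues modulo `p ^ 2`, at least `p - 1` are such that `p` divides `c * n + 1`
exactly. -/
theorem card_avoidsExact_prime {c p : ℕ} (hp : p.Prime) (hc : c.Coprime p) :
    ((Finset.range (p ^ 2)).filter (AvoidsExact c {p})).card + (p - 1) ≤ p ^ 2 := by
  have hp2 : 0 < p ^ 2 := pow_pos hp.pos 2
  obtain ⟨n0, hn0⟩ : ∃ n0, p ^ 2 ∣ c * n0 + 1 := by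
    have hcop : c.Coprime (p ^ 2) := hc.pow_right 2
    obtain ⟨m, -, hm⟩ := Nat.exists_mul_mod_eq_one_of_coprime hcop (by nlinarith [hp.two_le])
    refine ⟨m * (p ^ 2 - 1), ?_⟩
    rw [← Nat.modEq_zero_iff_dvd]
    have h1 : c * m ≡ 1 [MOD p ^ 2] := by
      rw [Nat.ModEq, hm, Nat.mod_eq_of_lt (by nlinarith [hp.two_le])]
    calc c * (m * (p ^ 2 - 1)) + 1 = c * m * (p ^ 2 - 1) + 1 := by ring
      _ ≡ 1 * (p ^ 2 - 1) + 1 [MOD p ^ 2] := (h1.mul_right _).add_right 1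
      _ = p ^ 2 := by omega
      _ ≡ 0 [MOD p ^ 2] := (Nat.modEq_zero_iff_dvd).2 dvd_rfl
  have hpc : ¬ p ∣ c := fun h => by
    have := Nat.eq_one_of_dvd_coprimes hc h dvd_rfl
    exact hp.one_lt.ne' this
  have hbad : (p - 1) ≤ ((Finset.range (p ^ 2)).filter fun n => ¬ AvoidsExact c {p} n).card := by
    have hcard : (p - 1) = (Finset.Ico 1 p).card := by simp
    rw [hcard]
    refine Finset.card_le_card_of_injOn (fun k => (n0 + p * k) % p ^ 2) ?_ ?_
    · intro k hk
      rw [Finset.mem_coe, Finset.mem_Ico] at hk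
      simp only [Finset.coe_filter, Finset.mem_range, Set.mem_ofPred_eq]
      refine ⟨Nat.mod_lt _ hp2, ?_⟩
      rw [avoidsExact_mod (by simp)]
      intro h
      have e : c * (n0 + p * k) + 1 = (c * n0 + 1) + p * (c * k) := by ring
      have h1 : p ∣ c * (n0 + p * k) + 1 := by
        rw [e]
        exact dvd_add ((dvd_pow_self p two_ne_zero).trans hn0) (dvd_mul_right _ _)
      have h2 := h p (by simp) h1
      rw [e, Nat.dvd_add_right hn0, sq] at h2
      have h3 := Nat.dvd_of_mul_dvd_mul_left hp.pos h2
      rcases hp.dvd_mul.1 h3 with h4 | h4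
      · exact hpc h4
      · exact absurd (Nat.le_of_dvd (by omega) h4) (by omega)
    · intro k hk l hl hkl
      rw [Finset.mem_coe, Finset.mem_Ico] at hk hl
      have h1 : p * k ≡ p * l [MOD p ^ 2] := Nat.ModEq.add_left_cancel' n0 hkl
      rw [sq] at h1
      have h2 : k ≡ l [MOD p] := Nat.ModEq.mul_left_cancel' hp.ne_zero h1
      exact Nat.ModEq.eq_of_lt_of_lt h2 hk.2 hl.2
  have := Finset.card_filter_add_card_filter_not (s := Finset.range (p ^ 2)) (AvoidsExact c {p})
  rw [Finset.card_range] at this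
  omega

open Classical in
/-- By the Chinese remainder theorem, the conditions at different primes are independent. -/
theorem card_avoidsExact_le {c : ℕ} (S : Finset ℕ) (hS : ∀ p ∈ S, p.Prime ∧ c.Coprime p) :
    (((Finset.range (∏ p ∈ S, p ^ 2)).filter (AvoidsExact c S)).card : ℝ) ≤
      (∏ p ∈ S, (1 - 1 / (2 * p) : ℝ)) * ((∏ p ∈ S, p ^ 2 : ℕ) : ℝ) := by
  induction S using Finset.induction_on with
  | empty => simpa using Finset.card_filter_le {0} (AvoidsExact c ∅)
  | insert p S hpS ih =>
    have hp := (hS p (Finset.mem_insert_self p S)).1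
    have ih := ih fun r hr => hS r (Finset.mem_insert_of_mem hr)
    have hcop : (p ^ 2).Coprime (∏ r ∈ S, r ^ 2) := by
      refine Nat.Coprime.prod_right fun r hr => ?_
      refine Nat.Coprime.pow 2 2 ((Nat.coprime_primes hp (hS r (Finset.mem_insert_of_mem hr)).1).2 ?_)
      rintro rfl
      exact hpS hr
    rw [Finset.prod_insert hpS, Finset.prod_insert hpS]
    set Q := ∏ r ∈ S, r ^ 2 with hQ
    have hQpos : 0 < Q := Finset.prod_pos fun r hr =>
      pow_pos (hS r (Finset.mem_insert_of_mem hr)).1.pos 2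
    have hp2 : 0 < p ^ 2 := pow_pos hp.pos 2
    have hle : ((Finset.range (p ^ 2 * Q)).filter (AvoidsExact c (insert p S))).card ≤
        ((Finset.range (p ^ 2)).filter (AvoidsExact c {p})).card *
        ((Finset.range Q).filter (AvoidsExact c S)).card := by
      rw [← Finset.card_product]
      refine Finset.card_le_card_of_injOn (fun n => (n % p ^ 2, n % Q)) ?_ ?_
      · intro n hn
        simp only [Finset.coe_filter, Finset.mem_range, Set.mem_ofPred_eq] at hn
        simp only [Finset.coe_product, Finset.coe_filter, Finset.mem_range, Set.mem_prod,
          Set.mem_ofPred_eq]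
        refine ⟨⟨Nat.mod_lt _ hp2, ?_⟩, ⟨Nat.mod_lt _ hQpos, ?_⟩⟩
        · rw [avoidsExact_mod (by simp)]
          intro r hr
          rw [Finset.mem_singleton] at hr
          exact hn.2 r (by simp [hr])
        · rw [avoidsExact_mod fun r hr => Finset.dvd_prod_of_mem _ hr]
          exact fun r hr => hn.2 r (Finset.mem_insert_of_mem hr)
      · intro n hn m hm hnm
        simp only [Finset.coe_filter, Finset.mem_range, Set.mem_ofPred_eq] at hn hm
        simp only [Prod.mk.injEq] at hnm
        have h : n ≡ m [MOD p ^ 2 * Q] :=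
          (Nat.modEq_and_modEq_iff_modEq_mul hcop).1 ⟨hnm.1, hnm.2⟩
        exact Nat.ModEq.eq_of_lt_of_lt h hn.1 hm.1
    have hg := card_avoidsExact_prime hp (hS p (Finset.mem_insert_self p S)).2
    have hpr : (2 : ℝ) ≤ p := by exact_mod_cast hp.two_le
    have hg' : (((Finset.range (p ^ 2)).filter (AvoidsExact c {p})).card : ℝ) ≤
        (1 - 1 / (2 * p)) * (p : ℝ) ^ 2 := by
      have h1 : (((Finset.range (p ^ 2)).filter (AvoidsExact c {p})).card : ℝ) + (p - 1) ≤
          (p : ℝ) ^ 2 := by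
        have := hp.one_le
        have h2 : (((Finset.range (p ^ 2)).filter (AvoidsExact c {p})).card + (p - 1) : ℕ) ≤
          ((p ^ 2 : ℕ) : ℝ) := by exact_mod_cast hg
        push_cast [Nat.cast_sub this] at h2
        exact h2
      have h2 : (1 - 1 / (2 * p)) * (p : ℝ) ^ 2 = (p : ℝ) ^ 2 - p / 2 := by
        field_simp
      rw [h2]
      linarith
    have hpos : (0 : ℝ) ≤ (1 - 1 / (2 * p)) * (p : ℝ) ^ 2 := le_trans (by positivity) hg'
    calc (((Finset.range (p ^ 2 * Q)).filter (AvoidsExact c (insert p S))).card : ℝ)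
        ≤ ((Finset.range (p ^ 2)).filter (AvoidsExact c {p})).card *
          ((Finset.range Q).filter (AvoidsExact c S)).card := by exact_mod_cast hle
      _ ≤ ((1 - 1 / (2 * p)) * (p : ℝ) ^ 2) * ((∏ r ∈ S, (1 - 1 / (2 * r) : ℝ)) * (Q : ℝ)) :=
          mul_le_mul hg' ih (by positivity) hpos
      _ = _ := by push_cast; ring

open Classical in
theorem card_avoidsExact_range {c : ℕ} (S : Finset ℕ) (k : ℕ) :
    ((Finset.range ((∏ p ∈ S, p ^ 2) * k)).filter (AvoidsExact c S)).card =
      k * ((Finset.range (∏ p ∈ S, p ^ 2)).filter (AvoidsExact c S)).card := by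
  set Q := ∏ p ∈ S, p ^ 2 with hQ
  rw [← Nat.count_eq_card_filter_range, ← Nat.count_eq_card_filter_range]
  induction k with
  | zero => simp
  | succ k ih =>
    rw [Nat.mul_succ, Nat.count_add, ih, Nat.succ_mul]
    congr 1
    rw [Nat.count_eq_card_filter_range, Nat.count_eq_card_filter_range]
    congr 1
    refine Finset.filter_congr fun n _ => ?_
    rw [← avoidsExact_mod (n := Q * k + n) (fun p hp => Finset.dvd_prod_of_mem _ hp),
      ← avoidsExact_mod (n := n) (fun p hp => Finset.dvd_prod_of_mem _ hp), ← hQ,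
      Nat.mul_add_mod]

/-- A sequence is lacunary modulo 2 if `a n` is even whenever some prime `p ≡ 31` modulo 40
divides `c * n + 1` exactly. -/
theorem lacunaryModTwo_of_exact {c : ℕ} {a : ℕ → ℤ}
    (hc : ∀ p : ℕ, p.Prime → p % 40 = 31 → c.Coprime p)
    (h : ∀ p : ℕ, p.Prime → p % 40 = 31 → ∀ n : ℕ, p ∣ c * n + 1 → ¬ p ^ 2 ∣ c * n + 1 →
      Even (a n)) : LacunaryModTwo a := by
  classical
  rw [LacunaryModTwo, HasOddDensity, Metric.tendsto_atTop]
  intro ε hε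
  obtain ⟨S, hS, hsum⟩ := exists_primes_sum_inv_gt (-2 * Real.log (ε / 2))
  set Q := ∏ p ∈ S, p ^ 2 with hQ
  have hQpos : 0 < Q := Finset.prod_pos fun p hp => pow_pos (hS p hp).1.pos 2
  set M := ((Finset.range Q).filter (AvoidsExact c S)).card with hM
  have hMQ : (M : ℝ) < ε / 2 * Q := by
    have h1 := card_avoidsExact_le (c := c) S fun p hp => ⟨(hS p hp).1, hc p (hS p hp).1 (hS p hp).2⟩
    rw [← hQ, ← hM] at h1
    refine lt_of_le_of_lt h1 (mul_lt_mul_of_pos_right ?_ (by exact_mod_cast hQpos))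
    calc ∏ p ∈ S, (1 - 1 / (2 * p) : ℝ) ≤ ∏ p ∈ S, Real.exp (-(1 / (2 * p))) := by
          refine Finset.prod_le_prod (fun p hp => ?_) fun p _ => ?_
          · have : (2 : ℝ) ≤ p := by exact_mod_cast (hS p hp).1.two_le
            rw [sub_nonneg, div_le_one (by positivity)]
            linarith
          · have := Real.add_one_le_exp (-(1 / (2 * (p : ℝ))))
            linarith
      _ = Real.exp (-(1 / 2) * ∑ p ∈ S, (1 : ℝ) / p) := by
          rw [← Real.exp_sum, Finset.mul_sum]
          congr 1
          refine Finset.sum_congr rfl fun p _ => ?_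
          rw [← one_div_mul_one_div]
          ring
      _ < Real.exp (Real.log (ε / 2)) := Real.exp_lt_exp.2 (by linarith)
      _ = ε / 2 := Real.exp_log (by positivity)
  obtain ⟨X, hX⟩ := exists_nat_gt (2 * M / ε)
  refine ⟨X + 1, fun x hx => ?_⟩
  have hx0 : (0 : ℝ) < x := by exact_mod_cast (by omega : 0 < x)
  have hcount : ((Finset.range (x + 1)).filter fun n => Odd (a n)).card ≤ (x / Q + 1) * M := by
    rw [hM, ← card_avoidsExact_range]
    refine Finset.card_le_card fun n hn => ?_
    rw [Finset.mem_filter, Finset.mem_range] at hn ⊢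
    refine ⟨lt_of_lt_of_le hn.1 ?_, fun p hp hpn => ?_⟩
    · rw [← hQ]
      have := Nat.lt_mul_div_succ x hQpos
      omega
    · by_contra hne
      exact (Int.not_even_iff_odd.2 hn.2) (h p (hS p hp).1 (hS p hp).2 n hpn hne)
  rw [Real.dist_eq, sub_zero, abs_of_nonneg (by positivity), div_lt_iff₀ hx0]
  have hdiv : ((x / Q : ℕ) : ℝ) ≤ x / Q := Nat.cast_div_le
  have hQr : (0 : ℝ) < Q := by exact_mod_cast hQpos
  have hXx : 2 * M / ε < x := hX.trans_le (by exact_mod_cast (by omega : X ≤ x))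
  rw [div_lt_iff₀ hε] at hXx
  calc ((((Finset.range (x + 1)).filter fun n => Odd (a n)).card : ℕ) : ℝ)
      ≤ ((x / Q : ℕ) + 1) * M := by exact_mod_cast hcount
    _ ≤ (x / Q + 1) * M := mul_le_mul_of_nonneg_right (by linarith) (by positivity)
    _ = x / Q * M + M := by ring
    _ < x / Q * (ε / 2 * Q) + x * ε / 2 := by
        refine add_lt_add (mul_lt_mul_of_pos_left hMQ (by positivity)) (by linarith)
    _ = ε * x := by field_simp; ring

/-! ### Arithmetic progressions and the theorem -/

theorem odd_regularB_four_mul_zero : Odd (regularB 25 (4 * 0)) := by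
  rw [← Int.not_even_iff_odd, even_regularB_iff, mul_zero,
    PowerSeries.coeff_zero_eq_constantCoeff_apply]
  have h := congrArg PowerSeries.constantCoeff regularMod_mul
  rw [map_mul, constantCoeff_eulerMod one_pos, constantCoeff_eulerMod (by norm_num), mul_one] at h
  rw [h]
  exact one_ne_zero

theorem odd_regularB_four_mul_zero_add_one : Odd (regularB 25 (4 * 0 + 1)) := by
  rw [← Int.not_even_iff_odd, even_regularB_iff, show 4 * 0 + 1 = 2 * (2 * 0 + 0) + 1 by norm_num,
    ← coeff_section2, ← coeff_section2, regularMod_four_mul_add_one]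
  simp [constantCoeff_eulerMod]

theorem odd_regularB_eight_mul_zero_add_three : Odd (regularB 25 (8 * 0 + 3)) := by
  rw [← Int.not_even_iff_odd, even_regularB_iff, coeff_regularMod_eight]
  simp [constantCoeff_eulerMod]

theorem coprime_two_pow_of_mod {p : ℕ} (hp : p.Prime) (h : p % 40 = 31) (k : ℕ) :
    (2 ^ k).Coprime p :=
  Nat.Coprime.pow_left k ((Nat.coprime_primes Nat.prime_two hp).2 (by omega))

/-- If `c * u ≡ 1` modulo `p ^ 2`, then `p` divides `c * m + 1` exactly once for every
`m = p ^ 2 * n + p * k - u` with `k` prime to `p`. -/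
theorem exact_dvd_of_mul_modEq_one {p c : ℕ} (hp : p.Prime) (hc : ¬ p ∣ c) {u : ℤ}
    (hu : c * u ≡ 1 [ZMOD (p : ℤ) ^ 2]) {k : ℕ} (hk : 1 ≤ k) (hkp : k < p) {n m : ℤ}
    (hm : m = (p : ℤ) ^ 2 * n + p * k - u) :
    (p : ℤ) ∣ c * m + 1 ∧ ¬ (p : ℤ) ^ 2 ∣ c * m + 1 := by
  have hp0 : (p : ℤ) ≠ 0 := by exact_mod_cast hp.ne_zero
  obtain ⟨t, ht⟩ := hu.dvd
  have e : (c * m + 1 : ℤ) = (p : ℤ) ^ 2 * (c * n + t) + p * (c * k) := by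
    rw [hm]
    linear_combination ht
  rw [e]
  refine ⟨⟨p * (c * n + t) + c * k, by ring⟩, fun h => ?_⟩
  rw [dvd_add_right (dvd_mul_right _ _), sq] at h
  have h1 : (p : ℤ) ∣ (c * k : ℕ) := by exact_mod_cast Int.dvd_of_mul_dvd_mul_left hp0 h
  rcases hp.dvd_mul.1 (Int.natCast_dvd_natCast.1 h1) with h2 | h2
  · exact hc h2
  · exact absurd (Nat.le_of_dvd (by omega) h2) (by omega)

theorem even_regularB_sixteen (n : ℕ) : Even (regularB 25 (16 * n + 11)) := by
  rw [show 16 * n + 11 = 8 * (2 * n + 1) + 3 by ring]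
  by_contra h
  obtain ⟨c, hc⟩ := exists_sq_of_odd_regularB_eight h
  have h1 : c ^ 2 % 4 = (c % 4) ^ 2 % 4 := Nat.pow_mod c 2 4
  have h2 : c % 4 < 4 := Nat.mod_lt _ (by norm_num)
  interval_cases c % 4 <;> omega

theorem dvd_of_arithProg_subset {a b c d : ℕ} (h : arithProg a b ⊆ arithProg c d) : c ∣ a := by
  obtain ⟨x, hx⟩ := h ⟨0, rfl⟩
  obtain ⟨y, hy⟩ := h ⟨1, rfl⟩
  dsimp only at hx hy
  zify at hx hy ⊢
  exact ⟨y - x, by linear_combination hx - hy⟩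

/-- The progression `8 * p ^ 2 * n + 4 * p - 1`, for odd `p`; its members are `8 * m + 3` with
`2 * m + 1 = p * (2 * p * n + 1)`. -/
def primeProg (p : ℕ) : Set ℕ := arithProg (8 * p ^ 2) (8 * ((p - 1) / 2) + 3)

theorem even_regularB_primeProg {p : ℕ} (hp : p.Prime) (h2 : p ≠ 2) {N : ℕ}
    (hN : N ∈ primeProg p) : Even (regularB 25 N) := by
  obtain ⟨n, rfl⟩ := hN
  have hodd := hp.eq_two_or_odd.resolve_left h2
  dsimp only
  rw [show 8 * p ^ 2 * n + (8 * ((p - 1) / 2) + 3) = 8 * (p ^ 2 * n + (p - 1) / 2) + 3 by ring]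
  have e : 2 * (p ^ 2 * n + (p - 1) / 2) + 1 = p ^ 2 * (2 * n) + p := by
    have : 2 * ((p - 1) / 2) + 1 = p := by omega
    linarith
  refine even_regularB_eight hp ?_ ?_ <;> rw [e]
  · exact ⟨p * (2 * n) + 1, by ring⟩
  · rw [Nat.dvd_add_right (dvd_mul_right _ _)]
    intro h
    have := Nat.le_of_dvd hp.pos h
    nlinarith [hp.two_le]

theorem eq_of_primeProg_subset {p r : ℕ} (hp : p.Prime) (hr : r.Prime)
    (h : primeProg p ⊆ primeProg r) : r = p := by
  have h1 := Nat.dvd_of_mul_dvd_mul_left (by norm_num) (dvd_of_arithProg_subset h)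
  exact (Nat.prime_dvd_prime_iff_eq hr hp).1 ((Nat.pow_dvd_pow_iff two_ne_zero).1 h1)

theorem not_primeProg_subset {p : ℕ} (hp : p.Prime) (h2 : p ≠ 2) :
    ¬ primeProg p ⊆ arithProg 16 11 := fun h => by
  have h1 : 8 * 2 ∣ 8 * p ^ 2 := dvd_of_arithProg_subset h
  have h3 := Nat.prime_two.dvd_of_dvd_pow (Nat.dvd_of_mul_dvd_mul_left (by norm_num) h1)
  exact h2 ((Nat.prime_dvd_prime_iff_eq Nat.prime_two hp).1 h3).symm

theorem not_subset_primeProg {p : ℕ} (hp : p.Prime) (h2 : p ≠ 2) :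
    ¬ arithProg 16 11 ⊆ primeProg p := fun h => by
  have h1 : 8 * p ^ 2 ∣ 8 * 2 := dvd_of_arithProg_subset h
  have h3 := Nat.dvd_of_mul_dvd_mul_left (by norm_num) h1
  have h4 := (dvd_pow_self p two_ne_zero).trans h3
  exact h2 ((Nat.prime_dvd_prime_iff_eq hp Nat.prime_two).1 h4)

theorem exists_antichain_even_regularB :
    ∃ S : Set (Set ℕ), S.Infinite ∧ IsAntichain (· ⊆ ·) S ∧ arithProg 16 11 ∈ S ∧
      ∀ P ∈ S, (∃ A B : ℕ, 0 < A ∧ P = arithProg (8 * A) (8 * B + 3)) ∧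
        ∀ N ∈ P, Even (regularB 25 N) := by
  have hinf : ({p : ℕ | p.Prime} \ {2}).Infinite :=
    Nat.infinite_setOfPred_prime.sdiff (Set.finite_singleton 2)
  refine ⟨insert (arithProg 16 11) (primeProg '' ({p : ℕ | p.Prime} \ {2})), ?_, ?_,
    Set.mem_insert _ _, ?_⟩
  · refine (hinf.image fun p hp r hr h => ?_).mono (Set.subset_insert _ _)
    exact (eq_of_primeProg_subset hp.1 hr.1 h.subset).symm
  · rintro P (rfl | ⟨p, hp, rfl⟩) Q (rfl | ⟨r, hr, rfl⟩) hne h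
    · exact hne rfl
    · exact not_subset_primeProg hr.1 hr.2 h
    · exact not_primeProg_subset hp.1 hp.2 h
    · exact hne (congrArg primeProg (eq_of_primeProg_subset hp.1 hr.1 h).symm)
  · rintro P (rfl | ⟨p, hp, rfl⟩)
    · refine ⟨⟨2, 1, two_pos, rfl⟩, ?_⟩
      rintro N ⟨n, rfl⟩
      exact even_regularB_sixteen n
    · exact ⟨⟨p ^ 2, (p - 1) / 2, pow_pos hp.1.pos 2, rfl⟩,
        fun N hN => even_regularB_primeProg hp.1 hp.2 hN⟩

theorem theorem2p11 :
    -- not identically zero modulo 2, but lacunary modulo 2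
    ((∃ n : ℕ, Odd (regularB 25 (4 * n))) ∧
      LacunaryModTwo (fun n => regularB 25 (4 * n))) ∧
    ((∃ n : ℕ, Odd (regularB 25 (4 * n + 1))) ∧
      LacunaryModTwo (fun n => regularB 25 (4 * n + 1))) ∧
    ((∃ n : ℕ, Odd (regularB 25 (8 * n + 3))) ∧
      LacunaryModTwo (fun n => regularB 25 (8 * n + 3))) ∧
    -- (1): `u` is any inverse of `4` modulo `p ^ 2`
    (∀ p : ℕ, p.Prime → (p % 40 = 31 ∨ p % 40 = 39) →
      ∀ u : ℤ, 4 * u ≡ 1 [ZMOD (p : ℤ) ^ 2] →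
      ∀ k : ℕ, 1 ≤ k → k < p → ∀ (n : ℤ) (m : ℕ),
        (m : ℤ) = (p : ℤ) ^ 2 * n + p * k - u → Even (regularB 25 (4 * m))) ∧
    -- (2): `u` is any inverse of `2` modulo `p ^ 2`
    (∀ p : ℕ, p.Prime → (p % 40 = 31 ∨ p % 40 = 39) →
      ∀ u : ℤ, 2 * u ≡ 1 [ZMOD (p : ℤ) ^ 2] →
      ∀ k : ℕ, 1 ≤ k → k < p → ∀ (n : ℤ) (m : ℕ),
        (m : ℤ) = (p : ℤ) ^ 2 * n + p * k - u → Even (regularB 25 (4 * m + 1))) ∧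
    -- (3)
    (∀ n : ℕ, Even (regularB 25 (40 * n + 34))) ∧
    -- (4)
    SeriesModEqTwo (PowerSeries.mk fun n => regularB 25 (8 * n + 3))
      (eulerF 1 ^ 12 + PowerSeries.X ^ 12 * eulerF 25 ^ 12) ∧
    (∀ n : ℕ, (¬ ∃ t : ℕ, n = 4 * (t + 1).choose 2) →
      (¬ ∃ t : ℕ, n = 12 + 100 * (t + 1).choose 2) → Even (regularB 25 (8 * n + 3))) ∧
    (∃ S : Set (Set ℕ), S.Infinite ∧ IsAntichain (· ⊆ ·) S ∧ arithProg 16 11 ∈ S ∧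
      ∀ P ∈ S, (∃ A B : ℕ, 0 < A ∧ P = arithProg (8 * A) (8 * B + 3)) ∧
        ∀ N ∈ P, Even (regularB 25 N)) ∧
    (∀ n : ℕ, Even (regularB 25 (16 * n + 11))) := by
  refine ⟨⟨⟨0, odd_regularB_four_mul_zero⟩, ?_⟩, ⟨⟨0, odd_regularB_four_mul_zero_add_one⟩, ?_⟩,
    ⟨⟨0, odd_regularB_eight_mul_zero_add_three⟩, ?_⟩, ?_, ?_, even_regularB_forty,
    seriesModEqTwo_eight, ?_, exists_antichain_even_regularB, even_regularB_sixteen⟩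
  · refine lacunaryModTwo_of_exact (c := 4) (fun p hp h => coprime_two_pow_of_mod hp h 2) ?_
    intro p hp h n h1 h2
    exact even_regularB_four_mul hp (Or.inl (by omega)) (by exact_mod_cast h1) (by exact_mod_cast h2)
  · refine lacunaryModTwo_of_exact (c := 2) (fun p hp h => coprime_two_pow_of_mod hp h 1) ?_
    intro p hp h n h1 h2
    exact even_regularB_four_mul_add_one hp (Or.inl (by omega)) (by exact_mod_cast h1)
      (by exact_mod_cast h2)
  · refine lacunaryModTwo_of_exact (c := 2) (fun p hp h => coprime_two_pow_of_mod hp h 1) ?_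
    exact fun p hp _ n h1 h2 => even_regularB_eight hp h1 h2
  · intro p hp h u hu k hk hkp n m hm
    have hc : ¬ p ∣ 4 := fun h4 => absurd (Nat.le_of_dvd (by norm_num) h4) (by omega)
    have := exact_dvd_of_mul_modEq_one hp hc hu hk hkp hm
    exact even_regularB_four_mul hp (by omega) this.1 this.2
  · intro p hp h u hu k hk hkp n m hm
    have hc : ¬ p ∣ 2 := fun h2 => absurd (Nat.le_of_dvd (by norm_num) h2) (by omega)
    have := exact_dvd_of_mul_modEq_one hp hc hu hk hkp hm
    exact even_regularB_four_mul_add_one hp (by omega) this.1 this.2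
  · intro n h1 h2
    by_contra h
    exact (odd_regularB_eight h).elim h1 h2
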